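/- Let $\mathcal D$ be the complex Lie algebra of regular differential operators on $\mathbb C^\times$. It is spanned by the operators $z^k f(D)$, where $k\in\mathbb Z$, $f\in\mathbb C[w]$ and $D=z\,\partial_z$. Let $\hat{\mathcal D}=\mathcal D\oplus\mathbb C C$ be its central extension with $C$ central and $$[z^r f(D),z^s g(D)]=z^{r+s}\bigl(f(D+s)g(D)-f(D)g(D+r)\bigr)+\Psi(z^rf(D),z^sg(D))\,C ,$$ where $\Psi$ is the skew-symmetric bilinear form with $$\Psi(z^rf(D),z^sg(D))=\begin{cases}\sum_{-r\le j\le -1}f(j)g(j+r)&\text{if } r=-s\ge 0,\\ 0&\text{if } r+s\ne 0.\end{cases}$$ Grade $\hat{\mathcal D}=\bigoplus_{j\in\mathbb Z}\hat{\mathcal D}_j$ by $\hat{\mathcal D}_j=\{z^jf(D)\}$ for $j\neq0$ and $\hat{\mathcal D}_0=\{f(D)+aC\}$. For a linear functional $\lambda\in\hat{\mathcal D}_0^*$, let $M(\lambda)=\mathcal U(\hat{\mathcal D})\otimes_{\mathcal U(\hat{\mathcal D}_0\oplus\hat{\mathcal D}_+)}\mathbb C_\lambda$ be the Verma module, where $\hat{\mathcal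 D}_+=\bigoplus_{j>0}\hat{\mathcal D}_j$ acts on $\mathbb C_\lambda=\mathbb C$ by $0$ and $h\in\hat{\mathcal D}_0$ acts by $\lambda(h)$, graded so that the generator $1\otimes 1$ has degree $0$. Let $L(\lambda)=\bigoplus_j L(\lambda)_j$ be the irreducible highest weight module, that is, the quotient of $M(\lambda)$ by its maximal proper graded submodule. It is called quasifinite if $\dim L(\lambda)_j<\infty$ for all $j$. The labels of $\lambda$ are $\Delta_n=-\lambda(D^n)$, $n\ge0$, and their generating series is $\Delta_\lambda(x)=\sum_{n\ge0}\Delta_n\frac{x^n}{n!}\in\mathbb C[[x]]$. A quasipolynomial is a finite linear combination of functions $p(x)e^{\alpha x}$ with $p$ a polynomial and $\alpha\in\mathbb C$, regarded as a formal power series in $x$. **Theorem 4.2.** For every $\lambda\in\hat{\mathcal D}_0^*$, the $\hat{\mathcal D}$-module $L(\lambda)$ is quasifinite if and only if there is a quasipolynomial $\phi$ with $\phi(0)=0$ such that $$\Delta_\lambda(x)=\frac{\phi(x)}{e^x-1}$$ (an identity of formal Laurent series in $x$). -/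

import Mathlib

open Polynomial

noncomputable section

/-! ## The Lie algebra `DHat`

The Lie algebra `D` of regular differential operators on `ℂˣ` has the elements `∑ₖ zᵏ fₖ(D)`, where
`D = z ∂_z` and `fₖ` is a polynomial; as a vector space it is `ℤ →₀ ℂ[X]`, the function
`Finsupp.single k f` standing for `zᵏ f(D)`.  The product of operators is
`(zʳ f(D)) (zˢ g(D)) = zʳ⁺ˢ f(D + s) g(D)`. -/

/-- The vector space underlying the central extension of `D` by one dimension: the pair `(x, a)`
is the element `x + a C`. -/
def DHat : Type := (ℤ →₀ ℂ[X]) × ℂ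

namespace DHat

instance : AddCommGroup DHat := inferInstanceAs (AddCommGroup ((ℤ →₀ ℂ[X]) × ℂ))

instance : Module ℂ DHat := inferInstanceAs (Module ℂ ((ℤ →₀ ℂ[X]) × ℂ))

/-- The element `zᵏ f(D)`. -/
def zD (k : ℤ) (f : ℂ[X]) : DHat := (Finsupp.single k f, 0)

/-- The central element `C`. -/
def central : DHat := (0, 1)

/-- The commutator of `zʳ f(D)` and `zˢ g(D)` in the algebra of differential operators:
`zʳ⁺ˢ (f(D + s) g(D) - f(D) g(D + r))`. -/
def monoComm (r : ℤ) (f : ℂ[X]) (s : ℤ) (g : ℂ[X]) : ℤ →₀ ℂ[X] :=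
  Finsupp.single (r + s) (f.comp (X + C (s : ℂ)) * g - f * g.comp (X + C (r : ℂ)))

/-- `∑_{-r ≤ j ≤ -1} F j` for `0 ≤ r`, and `-∑_{0 ≤ j ≤ -r - 1} F j` for `r ≤ 0`. -/
def signedSum (r : ℤ) (F : ℤ → ℂ) : ℂ :=
  ∑ j ∈ Finset.Ico (-r) 0, F j - ∑ j ∈ Finset.Ico 0 (-r), F j

/-- The cocycle `Ψ (zʳ f(D), zˢ g(D))`.  It vanishes for `r + s ≠ 0`; for `r = -s ≥ 0` it is
`∑_{-r ≤ j ≤ -1} f(j) g(j + r)`, and for `r = -s < 0` it is determined by skew-symmetry, which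
gives `-∑_{0 ≤ j ≤ -r - 1} f(j) g(j + r)`. -/
def monoCocycle (r : ℤ) (f : ℂ[X]) (s : ℤ) (g : ℂ[X]) : ℂ :=
  if r + s = 0 then signedSum r fun j => f.eval (j : ℂ) * g.eval ((j + r : ℤ) : ℂ) else 0

/-- The commutator of differential operators, extended bilinearly. -/
def comm (x y : ℤ →₀ ℂ[X]) : ℤ →₀ ℂ[X] := x.sum fun r f => y.sum fun s g => monoComm r f s g

/-- The cocycle `Ψ`, extended bilinearly. -/
def cocycle (x y : ℤ →₀ ℂ[X]) : ℂ := x.sum fun r f => y.sum fun s g => monoCocycle r f s g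

/-- The bracket `[x + a C, y + b C] = (x y - y x) + Ψ (x, y) C`. -/
instance : Bracket DHat DHat := ⟨fun x y => (comm x.1 y.1, cocycle x.1 y.1)⟩

/-! ### The Lie algebra axioms -/

theorem signedSum_zero (F : ℤ → ℂ) : signedSum 0 F = 0 := by simp [signedSum]

theorem signedSum_succ (r : ℤ) (F : ℤ → ℂ) :
    signedSum (r + 1) F = signedSum r F + F (-r - 1) := by
  unfold signedSum
  rcases le_or_gt 0 r with h | h
  · have h1 : Finset.Ico (-(r + 1)) 0 = insert (-r - 1) (Finset.Ico (-r) 0) := by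
      ext i; simp only [Finset.mem_Ico, Finset.mem_insert]; omega
    have h2 : Finset.Ico 0 (-(r + 1)) = ∅ := Finset.Ico_eq_empty (by omega)
    have h3 : Finset.Ico 0 (-r) = ∅ := Finset.Ico_eq_empty (by omega)
    rw [h1, h2, h3, Finset.sum_insert (by simp)]
    simp; ring
  · have h1 : Finset.Ico 0 (-r) = insert (-r - 1) (Finset.Ico 0 (-(r + 1))) := by
      ext i; simp only [Finset.mem_Ico, Finset.mem_insert]; omega
    have h2 : Finset.Ico (-(r + 1)) 0 = ∅ := Finset.Ico_eq_empty (by omega)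
    have h3 : Finset.Ico (-r) 0 = ∅ := Finset.Ico_eq_empty (by omega)
    rw [h1, h2, h3, Finset.sum_insert (by simp; omega)]
    simp

theorem signedSum_add_index (r s : ℤ) (F : ℤ → ℂ) :
    signedSum (r + s) F = signedSum r F + signedSum s (fun i => F (i - r)) := by
  induction s using Int.induction_on with
  | zero => simp [signedSum_zero]
  | succ n ih =>
    rw [← add_assoc, signedSum_succ, signedSum_succ, ih, add_assoc]
    congr 3; ring
  | pred n ih =>
    have h1 := signedSum_succ (r + (-(n : ℤ) - 1)) F
    have h2 := signedSum_succ (-(n : ℤ) - 1) (fun i => F (i - r))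
    rw [show r + (-(n : ℤ) - 1) + 1 = r + -(n : ℤ) by ring, ih] at h1
    rw [show -(n : ℤ) - 1 + 1 = -(n : ℤ) by ring] at h2
    rw [h2, show -(-(n : ℤ) - 1) - 1 - r = -(r + (-(n : ℤ) - 1)) - 1 by ring] at h1
    linear_combination -h1

theorem signedSum_add (r : ℤ) (F G : ℤ → ℂ) :
    signedSum r (fun i => F i + G i) = signedSum r F + signedSum r G := by
  simp only [signedSum, Finset.sum_add_distrib]; ring

theorem signedSum_sub (r : ℤ) (F G : ℤ → ℂ) :
    signedSum r (fun i => F i - G i) = signedSum r F - signedSum r G := by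
  simp only [signedSum, Finset.sum_sub_distrib]; ring

theorem signedSum_mul (r : ℤ) (c : ℂ) (F : ℤ → ℂ) :
    signedSum r (fun i => c * F i) = c * signedSum r F := by
  simp only [signedSum, ← Finset.mul_sum]; ring

theorem signedSum_neg_index (r : ℤ) (F : ℤ → ℂ) :
    signedSum (-r) (fun i => F (i - r)) = - signedSum r F := by
  have h := signedSum_add_index r (-r) F
  rw [add_neg_cancel, signedSum_zero] at h
  linear_combination -h

section Bilinear

variable {M : Type*} [AddCommGroup M] (B : ℤ → ℂ[X] → ℤ → ℂ[X] → M)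

theorem sum_add_left (hl : ∀ r f f' s g, B r (f + f') s g = B r f s g + B r f' s g)
    (x x' y : ℤ →₀ ℂ[X]) :
    ((x + x').sum fun r f => y.sum fun s g => B r f s g) =
      (x.sum fun r f => y.sum fun s g => B r f s g) +
        (x'.sum fun r f => y.sum fun s g => B r f s g) := by
  have h0 : ∀ r s g, B r 0 s g = 0 := fun r s g => by
    have h := hl r 0 0 s g
    rw [add_zero] at h
    simpa using h
  rw [Finsupp.sum_add_index']
  · intro r; simp [h0]
  · intro r f f'; simp only [hl]; exact Finsupp.sum_add

theorem sum_add_right (hr : ∀ r f s g g', B r f s (g + g') = B r f s g + B r f s g')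
    (x y y' : ℤ →₀ ℂ[X]) :
    (x.sum fun r f => (y + y').sum fun s g => B r f s g) =
      (x.sum fun r f => y.sum fun s g => B r f s g) +
        (x.sum fun r f => y'.sum fun s g => B r f s g) := by
  have h0 : ∀ r f s, B r f s 0 = 0 := fun r f s => by
    have h := hr r f s 0 0
    rw [add_zero] at h
    simpa using h
  rw [← Finsupp.sum_add]
  refine Finsupp.sum_congr fun r _ => ?_
  exact Finsupp.sum_add_index' (fun s => h0 r _ s) (fun s g g' => hr r _ s g g')

theorem sum_smul_right [Module ℂ M] (hs : ∀ r f s (t : ℂ) g, B r f s (t • g) = t • B r f s g)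
    (t : ℂ) (x y : ℤ →₀ ℂ[X]) :
    (x.sum fun r f => (t • y).sum fun s g => B r f s g) =
      t • (x.sum fun r f => y.sum fun s g => B r f s g) := by
  have h0 : ∀ r f s, B r f s 0 = 0 := fun r f s => by simpa using hs r f s 0 0
  rw [Finsupp.smul_sum]
  refine Finsupp.sum_congr fun r _ => ?_
  rw [Finsupp.sum_smul_index' (fun s => h0 r _ s), Finsupp.smul_sum]
  exact Finsupp.sum_congr fun s _ => hs r _ s t _

end Bilinear

theorem comm_add_left (x x' y : ℤ →₀ ℂ[X]) : comm (x + x') y = comm x y + comm x' y :=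
  sum_add_left monoComm (fun r f f' s g => by
    simp only [monoComm, ← Finsupp.single_add, add_comp]; congr 1; ring) x x' y

theorem comm_add_right (x y y' : ℤ →₀ ℂ[X]) : comm x (y + y') = comm x y + comm x y' :=
  sum_add_right monoComm (fun r f s g g' => by
    simp only [monoComm, ← Finsupp.single_add, add_comp]; congr 1; ring) x y y'

theorem comm_smul_right (t : ℂ) (x y : ℤ →₀ ℂ[X]) : comm x (t • y) = t • comm x y :=
  sum_smul_right monoComm (fun r f s t g => by
    simp only [monoComm, Finsupp.smul_single, smul_comp, mul_smul_comm, smul_sub]) t x y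

theorem cocycle_add_left (x x' y : ℤ →₀ ℂ[X]) :
    cocycle (x + x') y = cocycle x y + cocycle x' y :=
  sum_add_left monoCocycle (fun r f f' s g => by
    unfold monoCocycle
    split_ifs
    · simp only [eval_add, add_mul, signedSum_add]
    · simp) x x' y

theorem cocycle_add_right (x y y' : ℤ →₀ ℂ[X]) :
    cocycle x (y + y') = cocycle x y + cocycle x y' :=
  sum_add_right monoCocycle (fun r f s g g' => by
    unfold monoCocycle
    split_ifs
    · simp only [eval_add, mul_add, signedSum_add]
    · simp) x y y'

theorem cocycle_smul_right (t : ℂ) (x y : ℤ →₀ ℂ[X]) : cocycle x (t • y) = t • cocycle x y :=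
  sum_smul_right monoCocycle (fun r f s t g => by
    unfold monoCocycle
    split_ifs
    · simp only [eval_smul, smul_eq_mul, mul_left_comm _ t, signedSum_mul]
    · simp) t x y

theorem comm_single (r s : ℤ) (f g : ℂ[X]) :
    comm (Finsupp.single r f) (Finsupp.single s g) = monoComm r f s g := by
  unfold comm
  rw [Finsupp.sum_single_index, Finsupp.sum_single_index] <;> simp [monoComm]

theorem cocycle_single (r s : ℤ) (f g : ℂ[X]) :
    cocycle (Finsupp.single r f) (Finsupp.single s g) = monoCocycle r f s g := by
  unfold cocycle
  rw [Finsupp.sum_single_index, Finsupp.sum_single_index] <;> simp [monoCocycle, signedSum]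

theorem comm_zero_left (y : ℤ →₀ ℂ[X]) : comm 0 y = 0 := by simp [comm]
theorem comm_zero_right (y : ℤ →₀ ℂ[X]) : comm y 0 = 0 := by simp [comm]
theorem cocycle_zero_left (y : ℤ →₀ ℂ[X]) : cocycle 0 y = 0 := by simp [cocycle]
theorem cocycle_zero_right (y : ℤ →₀ ℂ[X]) : cocycle y 0 = 0 := by simp [cocycle]

theorem monoComm_skew (r : ℤ) (f : ℂ[X]) (s : ℤ) (g : ℂ[X]) :
    monoComm r f s g = - monoComm s g r f := by
  unfold monoComm
  rw [← Finsupp.single_neg, add_comm r s]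
  congr 1; ring

theorem monoCocycle_skew (r : ℤ) (f : ℂ[X]) (s : ℤ) (g : ℂ[X]) :
    monoCocycle r f s g = - monoCocycle s g r f := by
  unfold monoCocycle
  by_cases h : r + s = 0
  · obtain rfl : s = -r := by omega
    rw [if_pos h, if_pos (by omega), ← signedSum_neg_index (-r), neg_neg]
    congr 1
    funext j
    rw [show j - -r + -r = j by ring, sub_neg_eq_add, mul_comm]
  · rw [if_neg h, if_neg (by omega), neg_zero]

theorem monoComm_jacobi (r : ℤ) (f : ℂ[X]) (s : ℤ) (g : ℂ[X]) (t : ℤ) (h : ℂ[X]) :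
    comm (Finsupp.single r f) (monoComm s g t h) =
      comm (monoComm r f s g) (Finsupp.single t h) +
        comm (Finsupp.single s g) (monoComm r f t h) := by
  have key : ∀ (p : ℂ[X]) (a b : ℂ),
      (p.comp (X + C a)).comp (X + C b) = p.comp (X + C (a + b)) := fun p a b => by
    rw [comp_assoc, add_comp, X_comp, C_comp, add_assoc, ← C_add, add_comm b a]
  unfold monoComm
  simp only [comm_single]
  unfold monoComm
  rw [show r + s + t = r + (s + t) by ring, show s + (r + t) = r + (s + t) by ring,
    ← Finsupp.single_add]
  congr 1
  simp only [mul_comp, sub_comp, key, Int.cast_add]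
  rw [add_comm (t : ℂ) s, add_comm (t : ℂ) r, add_comm (s : ℂ) r]
  ring

theorem monoCocycle_jacobi (r : ℤ) (f : ℂ[X]) (s : ℤ) (g : ℂ[X]) (t : ℤ) (h : ℂ[X]) :
    cocycle (Finsupp.single r f) (monoComm s g t h) =
      cocycle (monoComm r f s g) (Finsupp.single t h) +
        cocycle (Finsupp.single s g) (monoComm r f t h) := by
  unfold monoComm
  simp only [cocycle_single]
  unfold monoCocycle
  by_cases hrst : r + s + t = 0
  · obtain rfl : t = -r - s := by omega
    rw [if_pos (by ring), if_pos (by ring), if_pos (by ring)]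
    simp only [eval_sub, eval_mul, eval_comp, eval_add, eval_X, eval_C, mul_sub, sub_mul,
      signedSum_sub]
    set P : ℤ → ℂ := fun i => f.eval (i : ℂ) * g.eval ((i + r : ℤ) : ℂ) *
      h.eval ((i + r + s : ℤ) : ℂ) with hP
    set Q : ℤ → ℂ := fun i => g.eval (i : ℂ) * f.eval ((i + s : ℤ) : ℂ) *
      h.eval ((i + r + s : ℤ) : ℂ) with hQ
    have e1 : (fun j : ℤ => f.eval (j : ℂ) * (g.eval (((j + r : ℤ) : ℂ) + ((-r - s : ℤ) : ℂ)) *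
        h.eval ((j + r : ℤ) : ℂ))) = fun i => Q (i - s) := by
      funext i; simp only [hQ]; push_cast; ring_nf
    have e2 : (fun j : ℤ => f.eval (j : ℂ) * (g.eval ((j + r : ℤ) : ℂ) *
        h.eval (((j + r : ℤ) : ℂ) + (s : ℂ)))) = P := by
      funext i; simp only [hP]; push_cast; ring_nf
    have e3 : (fun j : ℤ => f.eval ((j : ℂ) + (s : ℂ)) * g.eval (j : ℂ) *
        h.eval ((j + (r + s) : ℤ) : ℂ)) = Q := by
      funext i; simp only [hQ]; push_cast; ring_nf
    have e4 : (fun j : ℤ => f.eval (j : ℂ) * g.eval ((j : ℂ) + (r : ℂ)) *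
        h.eval ((j + (r + s) : ℤ) : ℂ)) = P := by
      funext i; simp only [hP]; push_cast; ring_nf
    have e5 : (fun j : ℤ => g.eval (j : ℂ) * (f.eval (((j + s : ℤ) : ℂ) + ((-r - s : ℤ) : ℂ)) *
        h.eval ((j + s : ℤ) : ℂ))) = fun i => P (i - r) := by
      funext i; simp only [hP]; push_cast; ring_nf
    have e6 : (fun j : ℤ => g.eval (j : ℂ) * (f.eval ((j + s : ℤ) : ℂ) *
        h.eval (((j + s : ℤ) : ℂ) + (r : ℂ)))) = Q := by
      funext i; simp only [hQ]; push_cast; ring_nf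
    rw [e1, e2, e3, e4, e5, e6]
    have hp := signedSum_add_index r s P
    have hq := signedSum_add_index s r Q
    rw [add_comm s r] at hq
    linear_combination hp - hq
  · rw [if_neg (by omega), if_neg (by omega), if_neg (by omega), add_zero]

theorem comm_skew (x y : ℤ →₀ ℂ[X]) : comm x y = - comm y x := by
  induction x using Finsupp.induction_linear with
  | zero => simp [comm_zero_left, comm_zero_right]
  | add x x' hx hx' => rw [comm_add_left, comm_add_right, hx, hx', neg_add]
  | single r f =>
    induction y using Finsupp.induction_linear with
    | zero => simp [comm_zero_left, comm_zero_right]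
    | add y y' hy hy' => rw [comm_add_left, comm_add_right, hy, hy', neg_add]
    | single s g => rw [comm_single, comm_single, monoComm_skew]

theorem cocycle_skew (x y : ℤ →₀ ℂ[X]) : cocycle x y = - cocycle y x := by
  induction x using Finsupp.induction_linear with
  | zero => simp [cocycle_zero_left, cocycle_zero_right]
  | add x x' hx hx' => rw [cocycle_add_left, cocycle_add_right, hx, hx', neg_add]
  | single r f =>
    induction y using Finsupp.induction_linear with
    | zero => simp [cocycle_zero_left, cocycle_zero_right]
    | add y y' hy hy' => rw [cocycle_add_left, cocycle_add_right, hy, hy', neg_add]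
    | single s g => rw [cocycle_single, cocycle_single, monoCocycle_skew]

theorem comm_jacobi (x y z : ℤ →₀ ℂ[X]) :
    comm x (comm y z) = comm (comm x y) z + comm y (comm x z) := by
  induction x using Finsupp.induction_linear with
  | zero => simp [comm_zero_left, comm_zero_right]
  | add x x' hx hx' => simp only [comm_add_left, comm_add_right, hx, hx']; abel
  | single r f =>
    induction y using Finsupp.induction_linear with
    | zero => simp [comm_zero_left, comm_zero_right]
    | add y y' hy hy' => simp only [comm_add_left, comm_add_right, hy, hy']; abel
    | single s g =>
      induction z using Finsupp.induction_linear with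
      | zero => simp [comm_zero_right]
      | add z z' hz hz' => simp only [comm_add_right, hz, hz']; abel
      | single t h => rw [comm_single, comm_single, comm_single, monoComm_jacobi]

theorem cocycle_jacobi (x y z : ℤ →₀ ℂ[X]) :
    cocycle x (comm y z) = cocycle (comm x y) z + cocycle y (comm x z) := by
  induction x using Finsupp.induction_linear with
  | zero => simp [comm_zero_left, cocycle_zero_left, cocycle_zero_right]
  | add x x' hx hx' =>
    simp only [comm_add_left, cocycle_add_left, cocycle_add_right, hx, hx']; abel
  | single r f =>
    induction y using Finsupp.induction_linear with
    | zero => simp [comm_zero_left, comm_zero_right, cocycle_zero_left, cocycle_zero_right]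
    | add y y' hy hy' =>
      simp only [comm_add_left, comm_add_right, cocycle_add_left, cocycle_add_right, hy, hy']; abel
    | single s g =>
      induction z using Finsupp.induction_linear with
      | zero => simp [comm_zero_right, cocycle_zero_right]
      | add z z' hz hz' => simp only [comm_add_right, cocycle_add_right, hz, hz']; abel
      | single t h => rw [comm_single, comm_single, comm_single, monoCocycle_jacobi]

instance : LieRing DHat where
  add_lie x y z := Prod.ext (comm_add_left x.1 y.1 z.1) (cocycle_add_left x.1 y.1 z.1)
  lie_add x y z := Prod.ext (comm_add_right x.1 y.1 z.1) (cocycle_add_right x.1 y.1 z.1)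
  lie_self x := Prod.ext (self_eq_neg.mp (comm_skew x.1 x.1))
    (self_eq_neg.mp (cocycle_skew x.1 x.1))
  leibniz_lie x y z := Prod.ext (comm_jacobi x.1 y.1 z.1) (cocycle_jacobi x.1 y.1 z.1)

instance : LieAlgebra ℂ DHat where
  lie_smul t x y := Prod.ext (comm_smul_right t x.1 y.1) (cocycle_smul_right t x.1 y.1)

/-- The component of degree `j` in the principal gradation: it is `{zʲ f(D)}` for `j ≠ 0`, and
`{f(D) + a C}` for `j = 0`. -/
def grade (j : ℤ) : Submodule ℂ DHat where
  carrier := {x | (∀ i, i ≠ j → x.1 i = 0) ∧ (j ≠ 0 → x.2 = 0)}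
  zero_mem' := ⟨fun _ _ => rfl, fun _ => rfl⟩
  add_mem' {x y} hx hy :=
    ⟨fun i hi => show x.1 i + y.1 i = 0 by rw [hx.1 i hi, hy.1 i hi, add_zero],
      fun hj => show x.2 + y.2 = 0 by rw [hx.2 hj, hy.2 hj, add_zero]⟩
  smul_mem' t x hx :=
    ⟨fun i hi => show t • x.1 i = 0 by rw [hx.1 i hi, smul_zero],
      fun hj => show t • x.2 = 0 by rw [hx.2 hj, smul_zero]⟩

theorem zD_mem_grade (k : ℤ) (f : ℂ[X]) : zD k f ∈ grade k :=
  ⟨fun _ hi => Finsupp.single_eq_of_ne hi, fun _ => rfl⟩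

end DHat

/-! ## Highest weight modules over a graded Lie algebra

Here `L` is a complex Lie algebra, `𝒢 j` is its component of degree `j : ℤ`, and `lam` is a linear
functional on `𝒢 0`.  An `L`-module is the same thing as a left module over the universal enveloping
algebra `U(L)`. -/

namespace HighestWeight

variable {L : Type*} [LieRing L] [LieAlgebra ℂ L] (𝒢 : ℤ → Submodule ℂ L)
  (lam : Module.Dual ℂ (𝒢 0))

/-- The left ideal of `U(L)` generated by the elements of positive degree of `L` and by the
elements `h - lam h` with `h` of degree `0`. -/
def vermaIdeal : Submodule (UniversalEnvelopingAlgebra ℂ L) (UniversalEnvelopingAlgebra ℂ L) :=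
  Submodule.span (UniversalEnvelopingAlgebra ℂ L)
    ({u | ∃ j : ℤ, 0 < j ∧ ∃ x ∈ 𝒢 j, u = UniversalEnvelopingAlgebra.ι ℂ x} ∪
      {u | ∃ h : 𝒢 0, u = UniversalEnvelopingAlgebra.ι ℂ (h : L) -
        algebraMap ℂ (UniversalEnvelopingAlgebra ℂ L) (lam h)})

/-- The Verma module `M(lam) = U(L) ⊗_{U(L₀ + L₊)} ℂ_lam`, as the quotient of `U(L)` by the left
ideal generated by the kernel of `U(L₀ + L₊) → ℂ_lam`. -/
abbrev Verma : Type _ := UniversalEnvelopingAlgebra ℂ L ⧸ vermaIdeal 𝒢 lam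

/-- The component of degree `j` of `U(L)`: the span of the products `x₁ ⋯ xₙ` where `xᵢ` is in `L`
of degree `dᵢ` and `d₁ + ⋯ + dₙ = j`.  An element `(d, x)` of the list `l` is a factor `x` of
degree `d`. -/
def envelopingGrade (j : ℤ) : Submodule ℂ (UniversalEnvelopingAlgebra ℂ L) :=
  Submodule.span ℂ {u | ∃ l : List (ℤ × L), (∀ p ∈ l, p.2 ∈ 𝒢 p.1) ∧
    (l.map Prod.fst).sum = j ∧
    u = (l.map fun p => UniversalEnvelopingAlgebra.ι ℂ p.2).prod}

/-- The component `M(lam)ⱼ` of the Verma module. -/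
def vermaGrade (j : ℤ) : Submodule ℂ (Verma 𝒢 lam) :=
  (envelopingGrade 𝒢 j).map ((vermaIdeal 𝒢 lam).mkQ.restrictScalars ℂ)

/-- A submodule `N` of `M(lam)` is graded if it is the sum of its intersections with the
components `M(lam)ⱼ`. -/
def IsGradedSubmodule (N : Submodule (UniversalEnvelopingAlgebra ℂ L) (Verma 𝒢 lam)) : Prop :=
  N.restrictScalars ℂ = ⨆ j : ℤ, N.restrictScalars ℂ ⊓ vermaGrade 𝒢 lam j

/-- The maximal proper graded submodule of `M(lam)`: the sum of all proper graded submodules. -/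
def maximalGradedSubmodule : Submodule (UniversalEnvelopingAlgebra ℂ L) (Verma 𝒢 lam) :=
  sSup {N | IsGradedSubmodule 𝒢 lam N ∧ N ≠ ⊤}

/-- The irreducible highest weight module `L(lam)`: the quotient of the Verma module by its maximal
proper graded submodule. -/
abbrev Irreducible : Type _ := Verma 𝒢 lam ⧸ maximalGradedSubmodule 𝒢 lam

/-- The component `L(lam)ⱼ`. -/
def irreducibleGrade (j : ℤ) : Submodule ℂ (Irreducible 𝒢 lam) :=
  (vermaGrade 𝒢 lam j).map ((maximalGradedSubmodule 𝒢 lam).mkQ.restrictScalars ℂ)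

/-- A family of subspaces `V j` of a vector space, the components of a graded module, is
quasifinite if all `V j` are finite-dimensional. -/
def IsQuasifinite {W : Type*} [AddCommGroup W] [Module ℂ W] (V : ℤ → Submodule ℂ W) : Prop :=
  ∀ j : ℤ, FiniteDimensional ℂ (V j)

end HighestWeight

/-! ## Labels and quasipolynomials -/

namespace DHat

/-- The label `Δₙ = -lam (Dⁿ)`. -/
def label (lam : Module.Dual ℂ (grade 0)) (n : ℕ) : ℂ := -lam ⟨zD 0 (X ^ n), zD_mem_grade 0 (X ^ n)⟩

/-- The generating series `∑ₙ Δₙ xⁿ / n!` of the labels. -/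
def labelSeries (lam : Module.Dual ℂ (grade 0)) : PowerSeries ℂ :=
  PowerSeries.mk fun n => label lam n / (n.factorial : ℂ)

end DHat

/-- A quasipolynomial, as a formal power series: a linear combination of series `p(x) e^{αx}` with
`p` a polynomial and `α` a complex number. -/
def IsQuasipolynomial (φ : PowerSeries ℂ) : Prop :=
  φ ∈ Submodule.span ℂ {ψ : PowerSeries ℂ | ∃ (p : ℂ[X]) (α : ℂ),
    ψ = (p : PowerSeries ℂ) * PowerSeries.rescale α (PowerSeries.exp ℂ)}

end

/-! Quasifiniteness is decided in degree -1. Write v for the highest weight vector. The value of λ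
on the bracket of z f(D) and z⁻¹ g(D) depends only on h = f(D - 1) g(D): it is ν(h) = λ(h(D) - h(D +
1)) + λ(C) h(0), the functional `bracketFunctional`. The heart of the proof is `isQuasifinite_iff`:
L(λ) is quasifinite exactly when ν vanishes on a nonzero ideal (b) of ℂ[D].

If L(λ)₋₁ is finite-dimensional, some z⁻¹ b(D) with b ≠ 0 kills v, and applying z g(D + 1) gives ν(g
b) = 0. Conversely, if ν vanishes on (b), the vectors z⁻¹ b(D) g(D) v of the Verma module form a
space stable under all operators of nonnegative degree, so they generate only proper submodules and
vanish in L(λ). Brackets then produce nonzero ideals killing v in every negative degree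
(`zD_prod_smul_eq_zero`), this property passes to descendants of v
(`IsLocallyFiniteVector.zD_smul`), and the components of L(λ) are finite-dimensional by induction on
the degree (`finiteDimensional_descendants`).

On exponential generating series of functionals on ℂ[D], multiplication by D becomes d/dx and the
shift D ↦ D + 1 becomes multiplication by eˣ. Hence ν vanishes on (b) if and only if b(d/dx) kills
its series, and such series are the quasipolynomials (`isQuasipolynomial_egf_iff`). Moreover (eˣ -
1) Δ_λ(x) is the series of ν minus the constant λ(C) (`exp_sub_one_mul_labelSeries`), and constants
are quasipolynomials.

The argument needs the highest weight line to survive in L(λ). Instead of a basis theorem for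
enveloping algebras, the Lie algebra is made to act on U(𝔫), with 𝔫 the negative part; composing
with the augmentation gives a functional ε on the Verma module which detects the maximal proper
graded submodule (`exists_functional_maximalGradedSubmodule`). -/

open Polynomial

noncomputable section

attribute [local instance] LieRing.ofAssociativeRing

/-! ### Generation of the enveloping algebra and induction on its elements. -/

namespace UniversalEnvelopingAlgebra

variable {L : Type*} [LieRing L] [LieAlgebra ℂ L]

theorem ι_mul_ι (x y : L) : ι ℂ x * ι ℂ y = ι ℂ ⁅x, y⁆ + ι ℂ y * ι ℂ x := by
  rw [LieHom.map_lie, LieRing.of_associative_ring_bracket, sub_add_cancel]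

/-- The enveloping algebra is generated by the Lie algebra. -/
theorem subalgebra_eq_top (S : Subalgebra ℂ (UniversalEnvelopingAlgebra ℂ L))
    (h : ∀ x : L, ι ℂ x ∈ S) : S = ⊤ := by
  let f : L →ₗ⁅ℂ⁆ S :=
    { toFun := fun x => ⟨ι ℂ x, h x⟩
      map_add' := fun x y => Subtype.ext (map_add _ x y)
      map_smul' := fun t x => Subtype.ext (map_smul _ t x)
      map_lie' := fun {x y} => Subtype.ext (LieHom.map_lie (ι ℂ) x y) }
  -- By the universal property `ι` lifts to an algebra map into `S`; followed by the inclusion it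
  -- fixes the generators, so it is the identity and `S` is everything.
  have key : S.val.comp (lift ℂ f) = AlgHom.id ℂ _ := by
    apply hom_ext
    ext x
    change ((lift ℂ f (ι ℂ x) : S) : UniversalEnvelopingAlgebra ℂ L) = ι ℂ x
    rw [lift_ι_apply]
    rfl
  rw [eq_top_iff]
  intro a _
  have := congrArg (fun g : UniversalEnvelopingAlgebra ℂ L →ₐ[ℂ] _ => g a) key
  change ((lift ℂ f a : S) : UniversalEnvelopingAlgebra ℂ L) = a at this
  rw [← this]
  exact (lift ℂ f a).2

variable {M : Type*} [AddCommGroup M] [Module ℂ M] [Module (UniversalEnvelopingAlgebra ℂ L) M]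
  [IsScalarTower ℂ (UniversalEnvelopingAlgebra ℂ L) M]

/-- A subspace of a module which is stable under the Lie algebra is a submodule. -/
theorem smul_mem_of_ι_smul_mem (S : Submodule ℂ M)
    (h : ∀ (x : L), ∀ m ∈ S, ι ℂ x • m ∈ S) (a : UniversalEnvelopingAlgebra ℂ L) {m : M}
    (hm : m ∈ S) : a • m ∈ S := by
  let T : Subalgebra ℂ (UniversalEnvelopingAlgebra ℂ L) :=
    { carrier := {a | ∀ m ∈ S, a • m ∈ S}
      mul_mem' := fun {a b} ha hb m hm => by rw [mul_smul]; exact ha _ (hb _ hm)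
      add_mem' := fun {a b} ha hb m hm => by rw [add_smul]; exact S.add_mem (ha _ hm) (hb _ hm)
      algebraMap_mem' := fun r m hm => by rw [algebraMap_smul]; exact S.smul_mem r hm }
  have hT : T = ⊤ := subalgebra_eq_top T (fun x m hm => h x m hm)
  have ha : a ∈ T := hT ▸ Algebra.mem_top
  exact ha m hm

/-- A subspace of the enveloping algebra which contains `1` and is stable under left multiplication
by the Lie algebra is everything. -/
theorem mem_of_ι_mul_mem (S : Submodule ℂ (UniversalEnvelopingAlgebra ℂ L)) (h1 : 1 ∈ S)
    (h : ∀ (x : L), ∀ m ∈ S, ι ℂ x * m ∈ S) (a : UniversalEnvelopingAlgebra ℂ L) : a ∈ S := by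
  simpa using smul_mem_of_ι_smul_mem S h a h1

end UniversalEnvelopingAlgebra

/-! ## The generic Verma module

Let `𝔫` be a subalgebra of `L`, `π : L → 𝔫` a projection along a subalgebra `𝔟`, and `χ` a linear
functional on `L` which vanishes on `𝔫` and restricts to a character of `𝔟`.  The module induced
from `χ` is realised on `U(𝔫)`; the construction does not use the theorem of
Poincaré, Birkhoff and Witt. -/

namespace GenericVerma

open UniversalEnvelopingAlgebra

variable {L : Type*} [LieRing L] [LieAlgebra ℂ L] (𝔫 : LieSubalgebra ℂ L)

/-- The action of `𝔫` on the linear maps `L → U(𝔫)`. -/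
def homAction : 𝔫 →ₗ⁅ℂ⁆ Module.End ℂ (L →ₗ[ℂ] UniversalEnvelopingAlgebra ℂ 𝔫) where
  toFun y :=
    { toFun := fun F => LinearMap.mulLeft ℂ (ι ℂ y) ∘ₗ F -
        F ∘ₗ (LieAlgebra.ad ℂ L (y : L) : L →ₗ[ℂ] L)
      map_add' := fun F G => by ext x; simp [mul_add]; abel
      map_smul' := fun t F => by ext x; simp [smul_sub] }
  map_add' y y' := by
    ext F x
    simp [add_mul]; abel
  map_smul' t y := by
    ext F x
    simp [smul_sub]
  map_lie' {y y'} := by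
    ext F x
    rw [LieRing.of_associative_ring_bracket]
    simp only [LinearMap.coe_mk, AddHom.coe_mk, LinearMap.sub_apply, LinearMap.comp_apply,
      LinearMap.mulLeft_apply, LieAlgebra.ad_apply, Module.End.mul_apply, LieHom.map_lie,
      LieRing.of_associative_ring_bracket, LieSubalgebra.coe_bracket, map_sub,
      sub_mul, mul_assoc]
    abel

variable (π : L →ₗ[ℂ] 𝔫) (χ : Module.Dual ℂ L)

/-- The action of `L` on the vector `1` of `U(𝔫)`. -/
def actOne : L →ₗ[ℂ] UniversalEnvelopingAlgebra ℂ 𝔫 :=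
  (ι ℂ : 𝔫 →ₗ⁅ℂ⁆ _).toLinearMap ∘ₗ π + (Algebra.linearMap ℂ _) ∘ₗ χ

/-- The action of `L` on `U(𝔫)`. -/
def act : L →ₗ[ℂ] Module.End ℂ (UniversalEnvelopingAlgebra ℂ 𝔫) :=
  ((LinearMap.applyₗ (R := ℂ) (actOne 𝔫 π χ)) ∘ₗ (lift ℂ (homAction 𝔫)).toLinearMap).flip

theorem homAction_apply (y : 𝔫) (F : L →ₗ[ℂ] UniversalEnvelopingAlgebra ℂ 𝔫) (x : L) :
    homAction 𝔫 y F x = ι ℂ y * F x - F ⁅(y : L), x⁆ := rfl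

theorem act_apply (x : L) (a : UniversalEnvelopingAlgebra ℂ 𝔫) :
    act 𝔫 π χ x a = lift ℂ (homAction 𝔫) a (actOne 𝔫 π χ) x := rfl

theorem act_one (x : L) : act 𝔫 π χ x 1 = ι ℂ (π x) + algebraMap ℂ _ (χ x) := by
  rw [act_apply, map_one]
  rfl

/-- The rule x y a = [x, y] a + y x a is what dictates `homAction`: the map a ↦ (x ↦ x a) must be
the `U(𝔫)`-linear map into the linear maps `L → U(𝔫)` which takes 1 to `actOne`. -/
theorem act_mul (x : L) (y : 𝔫) (a : UniversalEnvelopingAlgebra ℂ 𝔫) :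
    act 𝔫 π χ x (ι ℂ y * a) = act 𝔫 π χ ⁅x, (y : L)⁆ a + ι ℂ y * act 𝔫 π χ x a := by
  rw [act_apply, act_apply, act_apply, map_mul, lift_ι_apply, Module.End.mul_apply,
    homAction_apply, ← lie_skew x (y : L), map_neg]
  abel

variable {𝔫}

/-- At 1 this is the choice of `π` and `χ`. To pass from a to y' a, the statement must be known for
all y at once, since [y, y'] occurs. -/
theorem act_of_mem (hπ : ∀ y : 𝔫, π y = y) (hχ : ∀ y : 𝔫, χ y = 0) (y : 𝔫)
    (a : UniversalEnvelopingAlgebra ℂ 𝔫) : act 𝔫 π χ (y : L) a = ι ℂ y * a := by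
  let S : Submodule ℂ (UniversalEnvelopingAlgebra ℂ 𝔫) :=
    { carrier := {a | ∀ y : 𝔫, act 𝔫 π χ (y : L) a = ι ℂ y * a}
      zero_mem' := fun y => by rw [map_zero, mul_zero]
      add_mem' := fun {a b} ha hb y => by rw [map_add, ha, hb, mul_add]
      smul_mem' := fun t a ha y => by rw [map_smul, ha, mul_smul_comm] }
  refine mem_of_ι_mul_mem S (fun y => ?_) (fun y' a ha y => ?_) a y
  · rw [act_one, hπ, hχ, map_zero, add_zero, mul_one]
  · rw [act_mul, ha, ← LieSubalgebra.coe_bracket, ha, ← mul_assoc, ← mul_assoc, ι_mul_ι y y',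
      add_mul]

/-- Induction on a, again for all pairs at once: the case a = 1 uses that `χ` is a character of `ker
π`, and the passage to y a is the Jacobi identity. -/
theorem act_lie (hπ : ∀ y : 𝔫, π y = y) (hχ : ∀ y : 𝔫, χ y = 0)
    (hb : ∀ u u' : L, π u = 0 → π u' = 0 → π ⁅u, u'⁆ = 0 ∧ χ ⁅u, u'⁆ = 0) (x x' : L)
    (a : UniversalEnvelopingAlgebra ℂ 𝔫) :
    act 𝔫 π χ ⁅x, x'⁆ a = act 𝔫 π χ x (act 𝔫 π χ x' a) - act 𝔫 π χ x' (act 𝔫 π χ x a) := by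
  have hn : ∀ (x : L) (y : 𝔫) (a : UniversalEnvelopingAlgebra ℂ 𝔫), act 𝔫 π χ ⁅x, (y : L)⁆ a =
      act 𝔫 π χ x (act 𝔫 π χ y a) - act 𝔫 π χ y (act 𝔫 π χ x a) := fun x y a => by
    rw [act_of_mem π χ hπ hχ, act_of_mem π χ hπ hχ, act_mul, add_sub_cancel_right]
  let S : Submodule ℂ (UniversalEnvelopingAlgebra ℂ 𝔫) :=
    { carrier := {a | ∀ x x' : L, act 𝔫 π χ ⁅x, x'⁆ a =
        act 𝔫 π χ x (act 𝔫 π χ x' a) - act 𝔫 π χ x' (act 𝔫 π χ x a)}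
      zero_mem' := fun x x' => by simp only [map_zero, sub_zero]
      add_mem' := fun {a b} ha hb x x' => by simp only [map_add, ha x x', hb x x']; abel
      smul_mem' := fun t a ha x x' => by simp only [map_smul, ha x x', smul_sub] }
  refine mem_of_ι_mul_mem S (fun x x' => ?_) (fun y a ha x x' => ?_) a x x'
  -- Split x and x' along `𝔫` and `ker π`. Brackets with an element of `𝔫` are covered by `hn`;
  -- elements of `ker π` act on 1 by scalars, which commute.
  · obtain ⟨u, hu⟩ : ∃ u, u = x - (π x : L) := ⟨_, rfl⟩
    obtain ⟨u', hu'⟩ : ∃ u', u' = x' - (π x' : L) := ⟨_, rfl⟩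
    have hu0 : π u = 0 := by rw [hu, map_sub, hπ, sub_self]
    have hu0' : π u' = 0 := by rw [hu', map_sub, hπ, sub_self]
    have huu : act 𝔫 π χ ⁅u, u'⁆ 1 =
        act 𝔫 π χ u (act 𝔫 π χ u' 1) - act 𝔫 π χ u' (act 𝔫 π χ u 1) := by
      rw [act_one, (hb u u' hu0 hu0').1, (hb u u' hu0 hu0').2, act_one, act_one, hu0, hu0']
      simp only [map_zero, zero_add, Algebra.algebraMap_eq_smul_one, map_smul]
      rw [act_one, act_one, hu0, hu0']
      simp only [map_zero, zero_add, Algebra.algebraMap_eq_smul_one, smul_smul]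
      rw [mul_comm, sub_self]
    have h1 := hn x (π x') 1
    have h2 := hn u' (π x) 1
    rw [← lie_skew] at h2
    have ex : x = u + (π x : L) := by rw [hu, sub_add_cancel]
    have ex' : x' = u' + (π x' : L) := by rw [hu', sub_add_cancel]
    have e : ⁅x, x'⁆ = ⁅u, u'⁆ + ⁅(π x : L), u'⁆ + ⁅x, (π x' : L)⁆ := by
      conv_lhs => rw [ex', lie_add]
      conv_lhs => rw [ex, add_lie]
      rw [← ex]
    have hx : ∀ a, act 𝔫 π χ x a = act 𝔫 π χ u a + act 𝔫 π χ (π x) a := fun a => by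
      conv_lhs => rw [ex, map_add, LinearMap.add_apply]
    have hx' : ∀ a, act 𝔫 π χ x' a = act 𝔫 π χ u' a + act 𝔫 π χ (π x') a := fun a => by
      conv_lhs => rw [ex', map_add, LinearMap.add_apply]
    rw [map_neg, LinearMap.neg_apply] at h2
    rw [e, map_add, map_add, LinearMap.add_apply, LinearMap.add_apply, huu, h1,
      neg_eq_iff_eq_neg.mp h2]
    simp only [hx, hx', map_add]
    abel
  · have h1 := ha ⁅x, (y : L)⁆ x'
    have h2 := ha x ⁅x', (y : L)⁆
    have e : ⁅⁅x, x'⁆, (y : L)⁆ = ⁅x, ⁅x', (y : L)⁆⁆ + ⁅⁅x, (y : L)⁆, x'⁆ := by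
      rw [lie_lie x x' (y : L), ← lie_skew ⁅x, (y : L)⁆ x', sub_eq_add_neg]
    simp only [act_mul, map_add]
    rw [e, map_add, LinearMap.add_apply, h1, h2, ha x x', mul_sub]
    abel

/-- The representation of `L` on `U(𝔫)`. -/
def rep (hπ : ∀ y : 𝔫, π y = y) (hχ : ∀ y : 𝔫, χ y = 0)
    (hb : ∀ u u' : L, π u = 0 → π u' = 0 → π ⁅u, u'⁆ = 0 ∧ χ ⁅u, u'⁆ = 0) :
    L →ₗ⁅ℂ⁆ Module.End ℂ (UniversalEnvelopingAlgebra ℂ 𝔫) :=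
  { act 𝔫 π χ with
    map_lie' := fun {x x'} => by
      ext a
      exact act_lie π χ hπ hχ hb x x' a }

variable (𝔫) in
/-- The augmentation of `U(𝔫)`. -/
def augmentation : UniversalEnvelopingAlgebra ℂ 𝔫 →ₐ[ℂ] ℂ := lift ℂ 0

theorem augmentation_ι (y : 𝔫) : augmentation 𝔫 (ι ℂ y) = 0 := by
  rw [augmentation, lift_ι_apply]; rfl

/-- There is a linear functional on `U(L)` which is `1` at `1`, vanishes on `𝔫 U(L)` and is
equivariant for the right action of `𝔟 = ker π` and for the left action of the elements of `𝔟`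
which normalise `𝔫`. -/
theorem exists_functional (hπ : ∀ y : 𝔫, π y = y) (hχ : ∀ y : 𝔫, χ y = 0)
    (hb : ∀ u u' : L, π u = 0 → π u' = 0 → π ⁅u, u'⁆ = 0 ∧ χ ⁅u, u'⁆ = 0) :
    ∃ E : UniversalEnvelopingAlgebra ℂ L →ₗ[ℂ] ℂ, E 1 = 1 ∧
      (∀ (y : 𝔫) u, E (ι ℂ (y : L) * u) = 0) ∧
      (∀ x : L, π x = 0 → ∀ u, E (u * ι ℂ x) = χ x * E u) ∧
      (∀ h : L, π h = 0 → (∀ y : 𝔫, ⁅h, (y : L)⁆ ∈ 𝔫) → ∀ u, E (ι ℂ h * u) = χ h * E u) := by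
  obtain ⟨ρ, hρ⟩ : ∃ ρ, ρ = lift ℂ (rep π χ hπ hχ hb) := ⟨_, rfl⟩
  have hρι : ∀ x a, ρ (ι ℂ x) a = act 𝔫 π χ x a := fun x a => by rw [hρ, lift_ι_apply]; rfl
  refine ⟨(augmentation 𝔫).toLinearMap ∘ₗ (LinearMap.applyₗ (R := ℂ) 1) ∘ₗ ρ.toLinearMap,
    ?_, fun y u => ?_, fun x hx u => ?_, fun h hh hn u => ?_⟩ <;>
    simp only [LinearMap.comp_apply, AlgHom.toLinearMap_apply, LinearMap.applyₗ_apply_apply]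
  · simp only [map_one, Module.End.one_apply]
  · rw [map_mul, Module.End.mul_apply, hρι, act_of_mem π χ hπ hχ, map_mul, augmentation_ι, zero_mul]
  · rw [map_mul, Module.End.mul_apply, hρι, act_one, hx, map_zero, zero_add,
      Algebra.algebraMap_eq_smul_one, map_smul, map_smul, smul_eq_mul]
  · rw [map_mul, Module.End.mul_apply, hρι]
    -- The augmentation turns the action of h into the scalar `χ h` on all of `U(𝔫)`: at 1 by
    -- definition, and on y a both sides vanish because h y a = [h, y] a + y h a and [h, y] is in
    -- `𝔫`.
    let S : Submodule ℂ (UniversalEnvelopingAlgebra ℂ 𝔫) :=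
      LinearMap.ker ((augmentation 𝔫).toLinearMap ∘ₗ act 𝔫 π χ h -
        χ h • (augmentation 𝔫).toLinearMap)
    have key : ρ u 1 ∈ S := by
      refine mem_of_ι_mul_mem S ?_ (fun y a _ => ?_) _
      · simp [S, act_one, hh]
      · have e : act 𝔫 π χ ⁅h, (y : L)⁆ a = ι ℂ (⟨⁅h, (y : L)⁆, hn y⟩ : 𝔫) * a :=
          act_of_mem π χ hπ hχ ⟨⁅h, (y : L)⁆, hn y⟩ a
        rw [LinearMap.mem_ker, LinearMap.sub_apply, LinearMap.comp_apply, act_mul, e]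
        simp only [map_add, AlgHom.toLinearMap_apply, LinearMap.smul_apply, map_mul,
          augmentation_ι, zero_mul, smul_zero, add_zero, sub_zero]
    rw [LinearMap.mem_ker, LinearMap.sub_apply, sub_eq_zero] at key
    exact key

end GenericVerma

/-! ### The gradation of `DHat` and its splitting into negative and nonnegative degrees. -/

namespace DHat

/-- The elements of `DHat` whose components have degrees in `S`; the component of degree `0`
includes the multiples of `C`. -/
def supportedIn (S : Set ℤ) : Submodule ℂ DHat where
  carrier := {x | (∀ i, i ∉ S → x.1 i = 0) ∧ (0 ∉ S → x.2 = 0)}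
  zero_mem' := ⟨fun _ _ => rfl, fun _ => rfl⟩
  add_mem' {x y} hx hy :=
    ⟨fun i hi => show x.1 i + y.1 i = 0 by rw [hx.1 i hi, hy.1 i hi, add_zero],
      fun hj => show x.2 + y.2 = 0 by rw [hx.2 hj, hy.2 hj, add_zero]⟩
  smul_mem' t x hx :=
    ⟨fun i hi => show t • x.1 i = 0 by rw [hx.1 i hi, smul_zero],
      fun hj => show t • x.2 = 0 by rw [hx.2 hj, smul_zero]⟩

theorem mem_supportedIn {S : Set ℤ} {x : DHat} :
    x ∈ supportedIn S ↔ (∀ i, i ∉ S → x.1 i = 0) ∧ (0 ∉ S → x.2 = 0) := Iff.rfl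

theorem lie_mem_supportedIn {S T R : Set ℤ} (h : ∀ i ∈ S, ∀ j ∈ T, i + j ∈ R) {x y : DHat}
    (hx : x ∈ supportedIn S) (hy : y ∈ supportedIn T) : ⁅x, y⁆ ∈ supportedIn R := by
  have hS : ∀ r ∈ x.1.support, r ∈ S := fun r hr => by
    by_contra hc
    exact Finsupp.mem_support_iff.mp hr (hx.1 r hc)
  have hT : ∀ s ∈ y.1.support, s ∈ T := fun s hs => by
    by_contra hc
    exact Finsupp.mem_support_iff.mp hs (hy.1 s hc)
  refine ⟨fun i hi => ?_, fun h0 => ?_⟩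
  · change comm x.1 y.1 i = 0
    unfold comm Finsupp.sum
    rw [Finsupp.finsetSum_apply]
    refine Finset.sum_eq_zero fun r hr => ?_
    rw [Finsupp.finsetSum_apply]
    refine Finset.sum_eq_zero fun s hs => ?_
    exact Finsupp.single_eq_of_ne fun e => hi (e ▸ h r (hS r hr) s (hT s hs))
  · change cocycle x.1 y.1 = 0
    unfold cocycle Finsupp.sum
    refine Finset.sum_eq_zero fun r hr => Finset.sum_eq_zero fun s hs => ?_
    exact if_neg fun (e : r + s = 0) => h0 (e ▸ h r (hS r hr) s (hT s hs))

theorem mem_grade_iff {j : ℤ} {x : DHat} : x ∈ grade j ↔ x ∈ supportedIn {j} := by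
  rw [mem_supportedIn]
  change (_ ∧ _) ↔ _
  simp only [Set.mem_singleton_iff, ne_eq, eq_comm (a := j)]

theorem lie_mem_grade {i j : ℤ} {x y : DHat} (hx : x ∈ grade i) (hy : y ∈ grade j) :
    ⁅x, y⁆ ∈ grade (i + j) := by
  rw [mem_grade_iff] at *
  refine lie_mem_supportedIn ?_ hx hy
  rintro a rfl b rfl
  rfl

theorem grade_le_supportedIn {j : ℤ} {S : Set ℤ} (hj : j ∈ S) : grade j ≤ supportedIn S :=
  fun _ hx => ⟨fun i hi => hx.1 i fun e => hi (e ▸ hj), fun h0 => hx.2 fun e => h0 (e ▸ hj)⟩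

theorem central_mem_grade : central ∈ grade 0 := ⟨fun _ _ => rfl, fun h => (h rfl).elim⟩

theorem add_smul_central (x : DHat) :
    x = (x.1.sum fun k f => zD k f) + x.2 • central := by
  have h1 : ∀ y : ℤ →₀ ℂ[X], (y.sum fun k f => zD k f) = (y, 0) := fun y => by
    induction y using Finsupp.induction_linear with
    | zero => exact Finsupp.sum_zero_index
    | add y y' hy hy' =>
      rw [Finsupp.sum_add_index', hy, hy']
      · exact Prod.ext rfl (add_zero 0)
      · intro k; exact Prod.ext (Finsupp.single_zero k) rfl
      · intro k f g; exact Prod.ext (Finsupp.single_add k f g) (add_zero 0).symm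
    | single k f =>
      rw [Finsupp.sum_single_index]
      · rfl
      · exact Prod.ext (Finsupp.single_zero k) rfl
  rw [h1]
  refine Prod.ext ?_ ?_
  · change x.1 = x.1 + x.2 • (0 : ℤ →₀ ℂ[X])
    rw [smul_zero, add_zero]
  · change x.2 = 0 + x.2 • (1 : ℂ)
    rw [smul_eq_mul, mul_one, zero_add]

/-- `DHat` is spanned by homogeneous elements. -/
theorem homogeneous_induction {p : DHat → Prop} (hadd : ∀ x y, p x → p y → p (x + y))
    (hom : ∀ j, ∀ x ∈ grade j, p x) (x : DHat) : p x := by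
  rw [add_smul_central x]
  refine hadd _ _ ?_ (hom 0 _ ((grade 0).smul_mem _ central_mem_grade))
  exact Finset.sum_induction _ p hadd (hom 0 _ (grade 0).zero_mem)
    fun k _ => hom k _ (zD_mem_grade k _)

theorem zD_add (k : ℤ) (f g : ℂ[X]) : zD k (f + g) = zD k f + zD k g :=
  Prod.ext (Finsupp.single_add k f g) (add_zero 0).symm

theorem zD_smul (k : ℤ) (t : ℂ) (f : ℂ[X]) : zD k (t • f) = t • zD k f :=
  Prod.ext (Finsupp.smul_single t k f).symm (smul_zero t).symm

/-- The linear map `f ↦ zᵏ f(D)`. -/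
def zDLinear (k : ℤ) : ℂ[X] →ₗ[ℂ] DHat where
  toFun := zD k
  map_add' := zD_add k
  map_smul' := zD_smul k

theorem zDLinear_apply (k : ℤ) (f : ℂ[X]) : zDLinear k f = zD k f := rfl

theorem eq_zD_of_mem_grade {j : ℤ} (hj : j ≠ 0) {x : DHat} (hx : x ∈ grade j) :
    x = zD j (x.1 j) := by
  refine Prod.ext (Finsupp.ext fun i => ?_) (hx.2 hj)
  change x.1 i = Finsupp.single j (x.1 j) i
  by_cases h : i = j
  · subst h; rw [Finsupp.single_eq_same]
  · rw [hx.1 i h, Finsupp.single_eq_of_ne h]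

theorem eq_zD_add_of_mem_grade_zero {x : DHat} (hx : x ∈ grade 0) :
    x = zD 0 (x.1 0) + x.2 • central := by
  refine Prod.ext (Finsupp.ext fun i => ?_) ?_
  · change x.1 i = Finsupp.single 0 (x.1 0) i + (x.2 • (0 : ℤ →₀ ℂ[X])) i
    rw [smul_zero, Finsupp.zero_apply, add_zero]
    by_cases h : i = 0
    · subst h; rw [Finsupp.single_eq_same]
    · rw [hx.1 i h, Finsupp.single_eq_of_ne h]
  · change x.2 = 0 + x.2 • (1 : ℂ)
    rw [smul_eq_mul, mul_one, zero_add]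

theorem zD_lie_zD (r s : ℤ) (f g : ℂ[X]) :
    ⁅zD r f, zD s g⁆ =
      zD (r + s) (f.comp (X + C (s : ℂ)) * g - f * g.comp (X + C (r : ℂ))) +
        monoCocycle r f s g • central := by
  refine Prod.ext ?_ ?_
  · change comm (Finsupp.single r f) (Finsupp.single s g) =
      monoComm r f s g + monoCocycle r f s g • (0 : ℤ →₀ ℂ[X])
    rw [comm_single, smul_zero, add_zero]
  · change cocycle (Finsupp.single r f) (Finsupp.single s g) = 0 + monoCocycle r f s g • (1 : ℂ)
    rw [cocycle_single, smul_eq_mul, mul_one, zero_add]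

theorem zD_lie_zD_of_ne {r s : ℤ} (h : r + s ≠ 0) (f g : ℂ[X]) :
    ⁅zD r f, zD s g⁆ =
      zD (r + s) (f.comp (X + C (s : ℂ)) * g - f * g.comp (X + C (r : ℂ))) := by
  rw [zD_lie_zD, monoCocycle, if_neg h, zero_smul, add_zero]

theorem central_lie (x : DHat) : ⁅central, x⁆ = 0 :=
  Prod.ext (comm_zero_left x.1) (cocycle_zero_left x.1)

/-- The component of degree `0` is abelian. -/
theorem lie_eq_zero_of_mem_grade_zero {x y : DHat} (hx : x ∈ grade 0) (hy : y ∈ grade 0) :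
    ⁅x, y⁆ = 0 := by
  rw [eq_zD_add_of_mem_grade_zero hx, eq_zD_add_of_mem_grade_zero hy]
  have h : ⁅zD 0 (x.1 0), zD 0 (y.1 0)⁆ = 0 := by
    rw [zD_lie_zD]
    simp only [add_zero, Int.cast_zero, map_zero, comp_X, sub_self, monoCocycle, if_true,
      signedSum_zero, zero_smul]
    exact Prod.ext (Finsupp.single_zero _) rfl
  rw [add_lie, lie_add, h, lie_smul, smul_lie, central_lie, ← lie_skew, central_lie]
  simp

/-- The element `D` of degree `0` defines the gradation. -/
theorem D_lie {j : ℤ} {x : DHat} (hx : x ∈ grade j) : ⁅zD 0 X, x⁆ = (j : ℂ) • x := by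
  by_cases hj : j = 0
  · subst hj
    rw [lie_eq_zero_of_mem_grade_zero (zD_mem_grade 0 X) hx, Int.cast_zero, zero_smul]
  · rw [eq_zD_of_mem_grade hj hx, zD_lie_zD_of_ne (by simpa using hj), ← zD_smul]
    congr 1
    · ring
    · simp [add_mul, smul_eq_C_mul]

/-- The subalgebra of elements of negative degrees. -/
def negative : LieSubalgebra ℂ DHat :=
  { supportedIn (Set.Iio 0) with
    lie_mem' := fun hx hy => lie_mem_supportedIn (fun i hi j hj => by
      simp only [Set.mem_Iio] at *; omega) hx hy }

/-- The projection onto the elements of negative degrees along the other homogeneous elements. -/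
def negativePart : DHat →ₗ[ℂ] negative where
  toFun x := ⟨(x.1.filter (· < 0), 0),
    fun _ hi => Finsupp.filter_apply_neg _ _ hi, fun _ => rfl⟩
  map_add' _ _ := Subtype.ext (Prod.ext Finsupp.filter_add (add_zero 0).symm)
  map_smul' t _ := Subtype.ext (Prod.ext Finsupp.filter_smul (smul_zero t).symm)

theorem negativePart_coe (y : negative) : negativePart y = y := by
  refine Subtype.ext (Prod.ext ?_ ?_)
  · exact Finsupp.filter_eq_self_iff _ _ |>.mpr fun i hi => by
      by_contra hc
      exact hi (y.2.1 i hc)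
  · exact (y.2.2 Set.self_notMem_Iio).symm

theorem negativePart_eq_zero_iff {x : DHat} :
    negativePart x = 0 ↔ x ∈ supportedIn (Set.Ici 0) := by
  constructor
  · intro h
    refine ⟨fun i hi => ?_, fun h0 => (h0 (Set.mem_Ici.mpr le_rfl)).elim⟩
    have h1 : x.1.filter (· < 0) = 0 := congrArg (fun y : negative => y.1.1) h
    rw [← Finsupp.filter_apply_pos (· < 0) x.1 (not_le.mp hi), h1]
    rfl
  · intro h
    refine Subtype.ext (Prod.ext (Finsupp.ext fun i => ?_) rfl)
    change x.1.filter (· < 0) i = 0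
    by_cases hi : i < 0
    · rw [Finsupp.filter_apply_pos (· < 0) x.1 hi]
      exact h.1 i (not_le.mpr hi)
    · exact Finsupp.filter_apply_neg _ _ hi

variable (lam : Module.Dual ℂ (grade 0))

/-- The extension of a functional on the component of degree `0` by zero on the others. -/
def extendByZero : Module.Dual ℂ DHat where
  toFun x := lam ⟨(Finsupp.single 0 (x.1 0), x.2),
    fun _ hi => Finsupp.single_eq_of_ne hi, fun h => (h rfl).elim⟩
  map_add' x y := by
    rw [← map_add]
    exact congrArg lam (Subtype.ext (Prod.ext (Finsupp.single_add _ _ _) rfl))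
  map_smul' t x := by
    rw [RingHom.id_apply, ← map_smul]
    exact congrArg lam (Subtype.ext (Prod.ext (Finsupp.smul_single _ _ _).symm rfl))

theorem extendByZero_of_mem {x : DHat} (hx : x ∈ grade 0) : extendByZero lam x = lam ⟨x, hx⟩ := by
  refine congrArg lam (Subtype.ext (Prod.ext (Finsupp.ext fun i => ?_) rfl))
  change Finsupp.single 0 (x.1 0) i = x.1 i
  by_cases h : i = 0
  · subst h; rw [Finsupp.single_eq_same]
  · rw [hx.1 i h, Finsupp.single_eq_of_ne h]

theorem extendByZero_of_supportedIn {S : Set ℤ} (h0 : 0 ∉ S) {x : DHat} (hx : x ∈ supportedIn S) :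
    extendByZero lam x = 0 := by
  rw [← map_zero lam]
  refine congrArg lam (Subtype.ext (Prod.ext ?_ (hx.2 h0)))
  change Finsupp.single 0 (x.1 0) = 0
  rw [hx.1 0 h0, Finsupp.single_zero]

theorem exists_sub_mem_supportedIn_Ioi {x : DHat} (hx : x ∈ supportedIn (Set.Ici 0)) :
    ∃ h ∈ grade 0, ∃ p ∈ supportedIn (Set.Ioi 0), x = h + p := by
  refine ⟨(Finsupp.single 0 (x.1 0), x.2),
    ⟨fun _ hi => Finsupp.single_eq_of_ne hi, fun h => (h rfl).elim⟩,
    (x.1 - Finsupp.single 0 (x.1 0), 0), ⟨fun i hi => ?_, fun _ => rfl⟩, Prod.ext ?_ ?_⟩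
  · change x.1 i - Finsupp.single 0 (x.1 0) i = 0
    by_cases h : i = 0
    · subst h; rw [Finsupp.single_eq_same, sub_self]
    · rw [Finsupp.single_eq_of_ne h, sub_zero]
      refine hx.1 i ?_
      simp only [Set.mem_Ioi, Set.mem_Ici] at *
      omega
  · exact (add_sub_cancel _ _).symm
  · exact (add_zero _).symm

/-- Only the bracket of the degree 0 parts could contribute in degree 0, and that component is
abelian. This makes the extension of λ a character of the subalgebra of nonnegative degrees. -/
theorem extendByZero_lie {x y : DHat} (hx : x ∈ supportedIn (Set.Ici 0))
    (hy : y ∈ supportedIn (Set.Ici 0)) : extendByZero lam ⁅x, y⁆ = 0 := by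
  obtain ⟨h, hh, p, hp, rfl⟩ := exists_sub_mem_supportedIn_Ioi hx
  obtain ⟨h', hh', p', hp', rfl⟩ := exists_sub_mem_supportedIn_Ioi hy
  have h0 : (0 : ℤ) ∉ Set.Ioi 0 := Set.self_notMem_Ioi
  rw [add_lie, lie_add, lie_eq_zero_of_mem_grade_zero hh hh', zero_add]
  refine extendByZero_of_supportedIn lam h0 (Submodule.add_mem _ ?_ ?_)
  · rw [mem_grade_iff] at hh
    refine lie_mem_supportedIn (fun i hi j hj => ?_) hh hp'
    simp only [Set.mem_Ioi, Set.mem_singleton_iff] at *; omega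
  · refine lie_mem_supportedIn (fun i hi j hj => ?_) hp hy
    simp only [Set.mem_Ioi, Set.mem_Ici] at *; omega

open HighestWeight UniversalEnvelopingAlgebra

/-- The projection of the Verma module to its highest weight space, as a linear functional. -/
theorem exists_vermaFunctional :
    ∃ ε : Verma grade lam →ₗ[ℂ] ℂ, ε ((vermaIdeal grade lam).mkQ 1) = 1 ∧
      (∀ j < 0, ∀ y ∈ grade j, ∀ m, ε (ι ℂ y • m) = 0) ∧
      (∀ m, ε (ι ℂ (zD 0 X) • m) = extendByZero lam (zD 0 X) * ε m) := by
  obtain ⟨E, h1, hn, hr, hl⟩ := GenericVerma.exists_functional negativePart (extendByZero lam)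
    negativePart_coe (fun y => extendByZero_of_supportedIn lam Set.self_notMem_Iio y.2)
    (fun u u' hu hu' => by
      rw [negativePart_eq_zero_iff] at *
      refine ⟨lie_mem_supportedIn (fun i hi j hj => ?_) hu hu', extendByZero_lie lam hu hu'⟩
      simp only [Set.mem_Ici] at *; omega)
  -- The right equivariance of `E` kills the generators of the left ideal; carrying a left factor u
  -- makes the statement stable under left multiplication.
  have hE : ∀ w ∈ vermaIdeal grade lam, ∀ u, E (u * w) = 0 := fun w hw => by
    induction hw using Submodule.span_induction with
    | mem w hw =>
      rintro u
      rcases hw with ⟨j, hj, x, hx, rfl⟩ | ⟨h, rfl⟩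
      · rw [hr x (negativePart_eq_zero_iff.mpr (grade_le_supportedIn (Set.mem_Ici.mpr hj.le) hx)),
          extendByZero_of_supportedIn (S := Set.Ioi 0) lam Set.self_notMem_Ioi
            (grade_le_supportedIn (Set.mem_Ioi.mpr hj) hx), zero_mul]
      · rw [mul_sub, map_sub, hr _ (negativePart_eq_zero_iff.mpr
          (grade_le_supportedIn (Set.mem_Ici.mpr le_rfl) h.2)), extendByZero_of_mem lam h.2,
          Algebra.algebraMap_eq_smul_one, mul_smul_comm, map_smul, mul_one, smul_eq_mul, sub_self]
    | zero => intro u; rw [mul_zero, map_zero]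
    | add w w' _ _ hw hw' => intro u; rw [mul_add, map_add, hw, hw', add_zero]
    | smul a w _ hw => intro u; rw [smul_eq_mul, ← mul_assoc, hw]
  let ε : Verma grade lam →ₗ[ℂ] ℂ :=
    (((vermaIdeal grade lam).restrictScalars ℂ).liftQ E
      (fun w hw => by simpa using hE w hw 1)) ∘ₗ
      (Submodule.Quotient.restrictScalarsEquiv ℂ (vermaIdeal grade lam)).symm.toLinearMap
  have hε : ∀ u, ε ((vermaIdeal grade lam).mkQ u) = E u := fun u => rfl
  refine ⟨ε, by rw [hε, h1], fun j hj y hy m => ?_, fun m => ?_⟩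
  · obtain ⟨u, rfl⟩ := Submodule.mkQ_surjective _ m
    rw [← map_smul, hε, smul_eq_mul]
    exact hn ⟨y, grade_le_supportedIn (Set.mem_Iio.mpr hj) hy⟩ u
  · obtain ⟨u, rfl⟩ := Submodule.mkQ_surjective _ m
    rw [← map_smul, hε, hε, smul_eq_mul]
    refine hl _ (negativePart_eq_zero_iff.mpr
      (grade_le_supportedIn (Set.mem_Ici.mpr le_rfl) (zD_mem_grade 0 X))) (fun y => ?_) u
    have := zD_mem_grade 0 (X : ℂ[X])
    rw [mem_grade_iff] at this
    refine lie_mem_supportedIn (fun i hi j hj => ?_) this y.2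
    simp only [Set.mem_Iio, Set.mem_singleton_iff] at *; omega

end DHat

/-- By the modular law, as `A i` and the other `B j` already span everything while `B i` is disjoint
from the latter. It turns spanning sets of a highest weight module into exact descriptions of its
weight spaces. -/
theorem iSupIndep.eq_of_le_of_iSup_eq_top {κ V : Type*} [AddCommGroup V] [Module ℂ V]
    {A B : κ → Submodule ℂ V} (hB : iSupIndep B) (hAB : ∀ i, A i ≤ B i) (hA : ⨆ i, A i = ⊤)
    (i : κ) : A i = B i := by
  refine le_antisymm (hAB i) ?_
  have h1 : A i ⊔ ⨆ (j) (_ : j ≠ i), B j = ⊤ := by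
    rw [eq_top_iff, ← hA]
    refine iSup_le fun j => ?_
    by_cases h : j = i
    · subst h; exact le_sup_left
    · exact le_sup_of_le_right (le_iSup₂_of_le j h (hAB j))
  calc B i = (A i ⊔ ⨆ (j) (_ : j ≠ i), B j) ⊓ B i := by rw [h1, top_inf_eq]
    _ = A i ⊔ (⨆ (j) (_ : j ≠ i), B j) ⊓ B i := sup_inf_assoc_of_le _ (hAB i)
    _ ≤ A i := by rw [inf_comm, (hB i).eq_bot, sup_bot_eq]

/-! ### Weight spaces of D and descendants of a highest weight vector. -/

namespace DHat

open HighestWeight UniversalEnvelopingAlgebra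

section Module

variable {A : Type*} [AddCommGroup A] [Module ℂ A] [Module (UniversalEnvelopingAlgebra ℂ DHat) A]
  [IsScalarTower ℂ (UniversalEnvelopingAlgebra ℂ DHat) A]

omit [Module ℂ A] [IsScalarTower ℂ (UniversalEnvelopingAlgebra ℂ DHat) A] in
theorem ι_smul_ι_smul (x y : DHat) (m : A) :
    ι ℂ x • ι ℂ y • m = ι ℂ ⁅x, y⁆ • m + ι ℂ y • ι ℂ x • m := by
  rw [← mul_smul, ι_mul_ι, add_smul, mul_smul]

/-- If a subspace `W` is stable under the elements of degree at least `0`, then the submodule it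
generates lies in every subspace which contains `W` and is stable under the elements of negative
degree. -/
theorem smul_mem_of_negative_stable (W T : Submodule ℂ A)
    (hW : ∀ j, 0 ≤ j → ∀ x ∈ grade j, ∀ w ∈ W, ι ℂ x • w ∈ W) (hWT : W ≤ T)
    (hT : ∀ j < 0, ∀ x ∈ grade j, ∀ m ∈ T, ι ℂ x • m ∈ T)
    (a : UniversalEnvelopingAlgebra ℂ DHat) {w : A} (hw : w ∈ W) : a • w ∈ T := by
  let P : Set (Submodule ℂ A) :=
    {T | W ≤ T ∧ ∀ j < 0, ∀ x ∈ grade j, ∀ m ∈ T, ι ℂ x • m ∈ T}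
  let S : Submodule ℂ A := sInf P
  have hWS : W ≤ S := le_sInf fun T hT => hT.1
  have hS : ∀ j < 0, ∀ x ∈ grade j, ∀ m ∈ S, ι ℂ x • m ∈ S := fun j hj x hx m hm =>
    Submodule.mem_sInf.mpr fun T hT => hT.2 j hj x hx m (Submodule.mem_sInf.mp hm T hT)
  -- With `S` the smallest admissible subspace, it suffices that this subspace is admissible too:
  -- for y of negative degree, x y m = [x, y] m + y x m is again in `S`. Minimality then makes `S`
  -- stable under the whole Lie algebra.
  let S' : Submodule ℂ A :=
    { carrier := {m | m ∈ S ∧ ∀ x : DHat, ι ℂ x • m ∈ S}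
      zero_mem' := ⟨S.zero_mem, fun x => by rw [smul_zero]; exact S.zero_mem⟩
      add_mem' := fun hm hm' => ⟨S.add_mem hm.1 hm'.1, fun x => by
        rw [smul_add]; exact S.add_mem (hm.2 x) (hm'.2 x)⟩
      smul_mem' := fun t m hm => ⟨S.smul_mem t hm.1, fun x => by
        rw [smul_comm]; exact S.smul_mem t (hm.2 x)⟩ }
  have hSS' : S ≤ S' := by
    refine sInf_le ⟨fun w hw => ⟨hWS hw, fun x => ?_⟩, fun j hj y hy m hm =>
      ⟨hS j hj y hy m hm.1, fun x => ?_⟩⟩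
    · induction x using homogeneous_induction with
      | hadd x x' hx hx' => rw [map_add, add_smul]; exact S.add_mem hx hx'
      | hom j x hx =>
        rcases lt_or_ge j 0 with hj | hj
        · exact hS j hj x hx w (hWS hw)
        · exact hWS (hW j hj x hx w hw)
    · rw [ι_smul_ι_smul]
      exact S.add_mem (hm.2 _) (hS j hj y hy _ (hm.2 x))
  have hST : S ≤ T := sInf_le ⟨hWT, hT⟩
  exact hST (smul_mem_of_ι_smul_mem S (fun x m hm => (hSS' hm).2 x) a (hWS hw))

variable (lam : Module.Dual ℂ (grade 0))

variable (A) in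
/-- The eigenspace of `D` of eigenvalue `lam D + j`. -/
def weightSpace (j : ℤ) : Submodule ℂ A :=
  Module.End.eigenspace (Algebra.lsmul ℂ ℂ A (ι ℂ (zD 0 X)))
    (extendByZero lam (zD 0 X) + j)

theorem mem_weightSpace {j : ℤ} {m : A} : m ∈ weightSpace A lam j ↔
    ι ℂ (zD 0 X) • m = (extendByZero lam (zD 0 X) + j) • m :=
  Module.End.mem_eigenspace_iff

theorem iSupIndep_weightSpace : iSupIndep (weightSpace A lam) :=
  (Module.End.eigenspaces_iSupIndep
    (Algebra.lsmul ℂ ℂ A (ι ℂ (zD 0 X)))).comp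
      (f := fun j : ℤ => extendByZero lam (zD 0 X) + j) fun i j h => by simpa using h

theorem ι_smul_mem_weightSpace {i j : ℤ} {x : DHat} (hx : x ∈ grade i) {m : A}
    (hm : m ∈ weightSpace A lam j) : ι ℂ x • m ∈ weightSpace A lam (i + j) := by
  rw [mem_weightSpace] at *
  rw [ι_smul_ι_smul, D_lie hx, map_smul, smul_assoc, hm,
    smul_comm (ι ℂ x) (extendByZero lam (zD 0 X) + (j : ℂ)), ← add_smul]
  congr 1
  push_cast
  ring

theorem smul_mem_weightSpace_of_mem_envelopingGrade {i j : ℤ}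
    {u : UniversalEnvelopingAlgebra ℂ DHat} (hu : u ∈ envelopingGrade grade i) {m : A}
    (hm : m ∈ weightSpace A lam j) : u • m ∈ weightSpace A lam (i + j) := by
  induction hu using Submodule.span_induction with
  | mem u hu =>
    obtain ⟨l, hl, rfl, rfl⟩ := hu
    induction l with
    | nil => simpa using hm
    | cons p l ih =>
      simp only [List.map_cons, List.prod_cons, List.sum_cons, mul_smul, add_assoc]
      exact ι_smul_mem_weightSpace lam (hl p List.mem_cons_self)
        (ih fun q hq => hl q (List.mem_cons_of_mem p hq))
  | zero => rw [zero_smul]; exact Submodule.zero_mem _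
  | add u u' _ _ hu hu' => rw [add_smul]; exact Submodule.add_mem _ hu hu'
  | smul t u _ hu => rw [smul_assoc]; exact Submodule.smul_mem _ t hu

/-- `IsDescendant v n m` says that `m` is obtained from `v` by applying elements `z⁻ᵏ f(D)` with
`k > 0`, of total degree `-n`. -/
inductive IsDescendant (v : A) : ℕ → A → Prop
  | refl : IsDescendant v 0 v
  | step (k : ℕ) (f : ℂ[X]) (n : ℕ) (m : A) (h : IsDescendant v n m) :
      IsDescendant v (n + k + 1) (ι ℂ (zD (-(k + 1 : ℤ)) f) • m)

/-- The span of the descendants of `v` of degree `-n`. -/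
def descendants (v : A) (n : ℕ) : Submodule ℂ A := Submodule.span ℂ {m | IsDescendant v n m}

omit [IsScalarTower ℂ (UniversalEnvelopingAlgebra ℂ DHat) A] in
theorem descendants_zero (v : A) : descendants v 0 = ℂ ∙ v := by
  refine congrArg (Submodule.span ℂ) (Set.ext fun m => ⟨fun h => ?_, ?_⟩)
  · cases h; rfl
  · rintro rfl; exact .refl

/-- A highest weight vector of weight `lam`. -/
def IsHighestWeightVector (v : A) : Prop :=
  ∀ j, 0 ≤ j → ∀ x ∈ grade j, ι ℂ x • v = extendByZero lam x • v

variable {lam}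

theorem IsHighestWeightVector.mem_weightSpace {v : A} (hv : IsHighestWeightVector lam v) :
    v ∈ weightSpace A lam 0 := by
  rw [DHat.mem_weightSpace, Int.cast_zero, add_zero]
  exact hv 0 le_rfl _ (zD_mem_grade 0 X)

theorem IsDescendant.mem_weightSpace {v : A} (hv : IsHighestWeightVector lam v) {n : ℕ} {m : A}
    (h : IsDescendant v n m) : m ∈ weightSpace A lam (-n) := by
  induction h with
  | refl => simpa using hv.mem_weightSpace
  | step k f n m _ ih =>
    have := ι_smul_mem_weightSpace lam (zD_mem_grade (-(k + 1 : ℤ)) f) ih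
    rwa [show -(k + 1 : ℤ) + -n = -((n + k + 1 : ℕ) : ℤ) by push_cast; ring] at this

theorem descendants_le_weightSpace {v : A} (hv : IsHighestWeightVector lam v) (n : ℕ) :
    descendants v n ≤ weightSpace A lam (-n) :=
  Submodule.span_le.mpr fun _ hm => IsDescendant.mem_weightSpace hv hm

theorem smul_mem_iSup_descendants {v : A} (hv : IsHighestWeightVector lam v)
    (a : UniversalEnvelopingAlgebra ℂ DHat) : a • v ∈ ⨆ n, descendants v n := by
  refine smul_mem_of_negative_stable (ℂ ∙ v) (⨆ n, descendants v n) (fun j hj x hx w hw => ?_) ?_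
    (fun j hj x hx m hm => ?_) a (Submodule.mem_span_singleton_self v)
  · obtain ⟨t, rfl⟩ := Submodule.mem_span_singleton.mp hw
    rw [smul_comm, hv j hj x hx]
    exact Submodule.smul_mem _ _ (Submodule.smul_mem _ _ (Submodule.mem_span_singleton_self v))
  · rw [← descendants_zero]
    exact le_iSup (descendants v) 0
  · rw [eq_zD_of_mem_grade hj.ne hx]
    obtain ⟨k, rfl⟩ : ∃ k : ℕ, j = -(k + 1 : ℤ) := ⟨(-j - 1).toNat, by omega⟩
    have h : (⨆ n, descendants v n) ≤ (⨆ n, descendants v n).comap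
        (Algebra.lsmul ℂ ℂ A (ι ℂ (zD (-(k + 1 : ℤ)) (x.1 (-(k + 1 : ℤ)))))) :=
      iSup_le fun n => Submodule.span_le.mpr fun m hm =>
        Submodule.mem_iSup_of_mem (n + k + 1) (Submodule.subset_span (IsDescendant.step k _ n m hm))
    exact h hm

/-- The weight spaces of a highest weight module. -/
theorem weightSpace_eq {v : A} (hv : IsHighestWeightVector lam v)
    (hgen : ∀ m : A, ∃ a : UniversalEnvelopingAlgebra ℂ DHat, m = a • v) (j : ℤ) :
    weightSpace A lam j = if j ≤ 0 then descendants v j.natAbs else ⊥ := by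
  symm
  -- The descendants span the module and lie in eigenspaces of D for distinct eigenvalues, so they
  -- exhaust them.
  refine (iSupIndep_weightSpace (A := A) lam).eq_of_le_of_iSup_eq_top
    (A := fun j : ℤ => if j ≤ 0 then descendants v j.natAbs else ⊥) (fun j => ?_) ?_ j
  · split_ifs with h
    · have := descendants_le_weightSpace hv j.natAbs
      rwa [show -(j.natAbs : ℤ) = j by omega] at this
    · exact bot_le
  · rw [eq_top_iff]
    intro m _
    obtain ⟨a, rfl⟩ := hgen m
    refine (iSup_le fun n => ?_ : ⨆ n, descendants v n ≤ _) (smul_mem_iSup_descendants hv a)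
    refine le_iSup_of_le (-(n : ℤ)) ?_
    rw [if_pos (by omega), show (-(n : ℤ)).natAbs = n by omega]

end Module

/-! ### The Verma module, its maximal proper graded submodule and the irreducible quotient. -/

variable (lam : Module.Dual ℂ (grade 0))

/-- The generator of the Verma module. -/
def vermaVector : Verma grade lam := (vermaIdeal grade lam).mkQ 1

/-- The generator of the irreducible module. -/
def irreducibleVector : Irreducible grade lam :=
  (maximalGradedSubmodule grade lam).mkQ (vermaVector lam)

theorem mkQ_eq_smul_vermaVector (a : UniversalEnvelopingAlgebra ℂ DHat) :
    (vermaIdeal grade lam).mkQ a = a • vermaVector lam := by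
  rw [vermaVector, ← map_smul, smul_eq_mul, mul_one]

theorem exists_eq_smul_vermaVector (m : Verma grade lam) :
    ∃ a : UniversalEnvelopingAlgebra ℂ DHat, m = a • vermaVector lam := by
  obtain ⟨a, rfl⟩ := Submodule.mkQ_surjective _ m
  exact ⟨a, mkQ_eq_smul_vermaVector lam a⟩

theorem exists_eq_smul_irreducibleVector (m : Irreducible grade lam) :
    ∃ a : UniversalEnvelopingAlgebra ℂ DHat, m = a • irreducibleVector lam := by
  obtain ⟨w, rfl⟩ := Submodule.mkQ_surjective _ m
  obtain ⟨a, rfl⟩ := exists_eq_smul_vermaVector lam w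
  exact ⟨a, map_smul _ _ _⟩

theorem isHighestWeightVector_vermaVector : IsHighestWeightVector lam (vermaVector lam) := by
  intro j hj x hx
  rw [← mkQ_eq_smul_vermaVector]
  rcases hj.eq_or_lt with rfl | hj
  · rw [extendByZero_of_mem lam hx, ← algebraMap_smul (UniversalEnvelopingAlgebra ℂ DHat),
      ← mkQ_eq_smul_vermaVector, ← sub_eq_zero, ← map_sub]
    exact (Submodule.Quotient.mk_eq_zero _).mpr (Submodule.subset_span (Or.inr ⟨⟨x, hx⟩, rfl⟩))
  · rw [extendByZero_of_supportedIn (S := Set.Ioi 0) lam Set.self_notMem_Ioi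
      (grade_le_supportedIn (Set.mem_Ioi.mpr hj) hx), zero_smul]
    exact (Submodule.Quotient.mk_eq_zero _).mpr (Submodule.subset_span (Or.inl ⟨j, hj, x, hx, rfl⟩))

theorem isHighestWeightVector_irreducibleVector :
    IsHighestWeightVector lam (irreducibleVector lam) := by
  intro j hj x hx
  rw [irreducibleVector, ← map_smul, isHighestWeightVector_vermaVector lam j hj x hx]
  exact ((maximalGradedSubmodule grade lam).mkQ.restrictScalars ℂ).map_smul _ _

theorem vermaGrade_le_weightSpace (j : ℤ) :
    vermaGrade grade lam j ≤ weightSpace (Verma grade lam) lam j := by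
  rintro _ ⟨u, hu, rfl⟩
  change (vermaIdeal grade lam).mkQ u ∈ _
  rw [mkQ_eq_smul_vermaVector]
  simpa using smul_mem_weightSpace_of_mem_envelopingGrade lam hu
    (isHighestWeightVector_vermaVector lam).mem_weightSpace

theorem irreducibleGrade_le_weightSpace (j : ℤ) :
    irreducibleGrade grade lam j ≤ weightSpace (Irreducible grade lam) lam j := by
  rintro _ ⟨m, ⟨u, hu, rfl⟩, rfl⟩
  change (maximalGradedSubmodule grade lam).mkQ ((vermaIdeal grade lam).mkQ u) ∈ _
  rw [mkQ_eq_smul_vermaVector, map_smul]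
  have := smul_mem_weightSpace_of_mem_envelopingGrade lam hu
    (isHighestWeightVector_irreducibleVector lam).mem_weightSpace
  rwa [add_zero] at this

theorem ι_mul_mem_envelopingGrade {i j : ℤ} {x : DHat} (hx : x ∈ grade i)
    {u : UniversalEnvelopingAlgebra ℂ DHat} (hu : u ∈ envelopingGrade grade j) :
    ι ℂ x * u ∈ envelopingGrade grade (i + j) := by
  induction hu using Submodule.span_induction with
  | mem u hu =>
    obtain ⟨l, hl, rfl, rfl⟩ := hu
    refine Submodule.subset_span ⟨(i, x) :: l, fun p hp => ?_, by simp, by simp⟩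
    rcases List.mem_cons.mp hp with rfl | hp
    · exact hx
    · exact hl p hp
  | zero => rw [mul_zero]; exact Submodule.zero_mem _
  | add u u' _ _ hu hu' => rw [mul_add]; exact Submodule.add_mem _ hu hu'
  | smul t u _ hu => rw [mul_smul_comm]; exact Submodule.smul_mem _ t hu

theorem one_mem_envelopingGrade :
    (1 : UniversalEnvelopingAlgebra ℂ DHat) ∈ envelopingGrade grade 0 :=
  Submodule.subset_span ⟨[], by simp⟩

theorem ι_smul_mem_vermaGrade {i j : ℤ} {x : DHat} (hx : x ∈ grade i) {m : Verma grade lam}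
    (hm : m ∈ vermaGrade grade lam j) : ι ℂ x • m ∈ vermaGrade grade lam (i + j) := by
  obtain ⟨u, hu, rfl⟩ := hm
  exact ⟨ι ℂ x * u, ι_mul_mem_envelopingGrade hx hu, (vermaIdeal grade lam).mkQ.map_smul _ _⟩

theorem vermaVector_mem_vermaGrade : vermaVector lam ∈ vermaGrade grade lam 0 :=
  ⟨1, one_mem_envelopingGrade, rfl⟩

/-- A submodule generated by a homogeneous element is graded. -/
theorem isGradedSubmodule_span_singleton {j : ℤ} {w : Verma grade lam}
    (hw : w ∈ vermaGrade grade lam j) :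
    IsGradedSubmodule grade lam (Submodule.span (UniversalEnvelopingAlgebra ℂ DHat) {w}) := by
  set N := Submodule.span (UniversalEnvelopingAlgebra ℂ DHat) {w}
  have hwN : w ∈ N := Submodule.mem_span_singleton_self w
  refine le_antisymm (fun m hm => ?_) (iSup_le fun _ => inf_le_left)
  obtain ⟨a, rfl⟩ := Submodule.mem_span_singleton.mp hm
  refine smul_mem_of_ι_smul_mem _ (fun x m hm => ?_) a (Submodule.mem_iSup_of_mem j ⟨hwN, hw⟩)
  induction x using homogeneous_induction with
  | hadd x x' hx hx' => rw [map_add, add_smul]; exact Submodule.add_mem _ hx hx'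
  | hom i x hx =>
    have h : (⨆ j, N.restrictScalars ℂ ⊓ vermaGrade grade lam j) ≤
        (⨆ j, N.restrictScalars ℂ ⊓ vermaGrade grade lam j).comap
          (Algebra.lsmul ℂ ℂ (Verma grade lam) (ι ℂ x)) :=
      iSup_le fun j m hm => Submodule.mem_iSup_of_mem (i + j)
        ⟨N.smul_mem _ hm.1, ι_smul_mem_vermaGrade lam hx hm.2⟩
    exact h hm

/-- The maximal proper graded submodule, described by the projection to the highest weight space. -/
theorem exists_functional_maximalGradedSubmodule :
    ∃ ε : Verma grade lam →ₗ[ℂ] ℂ, ε (vermaVector lam) = 1 ∧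
      (∀ j < 0, ∀ y ∈ grade j, ∀ m, ε (ι ℂ y • m) = 0) ∧
      (∀ m ∈ maximalGradedSubmodule grade lam, ε m = 0) ∧
      (∀ j, ∀ w ∈ vermaGrade grade lam j,
        (∀ a : UniversalEnvelopingAlgebra ℂ DHat, ε (a • w) = 0) →
          w ∈ maximalGradedSubmodule grade lam) := by
  obtain ⟨ε, h1, hn, hD⟩ := exists_vermaFunctional lam
  refine ⟨ε, h1, hn, ?_, fun j w hw ha => ?_⟩
  · have hgr : ∀ N, IsGradedSubmodule grade lam N → N ≠ ⊤ → ∀ m ∈ N, ε m = 0 := by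
      intro N hN hT
      have hle : N.restrictScalars ℂ ≤ LinearMap.ker ε := by
        rw [hN]
        refine iSup_le fun j m hm => ?_
        have hmw := vermaGrade_le_weightSpace lam j hm.2
        rw [LinearMap.mem_ker]
        by_cases hj : j = 0
        -- The component of degree 0 is the line of the generator, so a nonzero element of it in `N`
        -- would make `N` everything.
        · subst hj
          rw [weightSpace_eq (isHighestWeightVector_vermaVector lam)
            (exists_eq_smul_vermaVector lam), if_pos le_rfl, Int.natAbs_zero,
            descendants_zero] at hmw
          obtain ⟨t, rfl⟩ := Submodule.mem_span_singleton.mp hmw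
          by_cases ht : t = 0
          · rw [ht, zero_smul, map_zero]
          · refine (hT ?_).elim
            have hv : vermaVector lam ∈ N := by
              have := (N.restrictScalars ℂ).smul_mem t⁻¹ hm.1
              rwa [smul_smul, inv_mul_cancel₀ ht, one_smul] at this
            rw [eq_top_iff]
            intro m' _
            obtain ⟨a, rfl⟩ := exists_eq_smul_vermaVector lam m'
            exact N.smul_mem a hv
        -- On a weight vector of degree j, the functional sees D both as λ(D) + j and as λ(D), so it
        -- vanishes for j ≠ 0.
        · have h := hD m
          rw [(mem_weightSpace lam).mp hmw, map_smul, smul_eq_mul, add_mul, add_eq_left,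
            mul_eq_zero] at h
          exact h.resolve_left (Int.cast_ne_zero.mpr hj)
      exact fun m hm => hle hm
    intro m hm
    have h2 : ∀ a : UniversalEnvelopingAlgebra ℂ DHat, ε (a • m) = 0 := by
      rw [maximalGradedSubmodule, sSup_eq_iSup'] at hm
      induction hm using Submodule.iSup_induction' with
      | mem N m hm => exact fun a => hgr N.1 N.2.1 N.2.2 _ (N.1.smul_mem a hm)
      | zero => intro a; rw [smul_zero, map_zero]
      | add m m' _ _ hm hm' => intro a; rw [smul_add, map_add, hm, hm', add_zero]
    simpa using h2 1
  -- The submodule generated by w is graded, and proper because ε is 1 on the generator of the Verma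
  -- module but 0 on all multiples of w.
  · have hN := isGradedSubmodule_span_singleton lam hw
    have hmem : Submodule.span (UniversalEnvelopingAlgebra ℂ DHat) {w} ∈
        {N | IsGradedSubmodule grade lam N ∧ N ≠ ⊤} := by
      refine ⟨hN, fun htop => ?_⟩
      have : vermaVector lam ∈ Submodule.span (UniversalEnvelopingAlgebra ℂ DHat) {w} :=
        htop ▸ Submodule.mem_top
      obtain ⟨a, h⟩ := Submodule.mem_span_singleton.mp this
      have h0 := ha a
      rw [h, vermaVector, h1] at h0
      exact one_ne_zero h0
    exact le_sSup hmem (Submodule.mem_span_singleton_self w)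

end DHat

/-! ### Finite-dimensionality from annihilating ideals of polynomials. -/

namespace DHat

open HighestWeight UniversalEnvelopingAlgebra

section Annihilator

variable {A : Type*} [AddCommGroup A] [Module ℂ A] [Module (UniversalEnvelopingAlgebra ℂ DHat) A]
  [IsScalarTower ℂ (UniversalEnvelopingAlgebra ℂ DHat) A]

/-- The linear map `f ↦ zᵏ f(D) m`. -/
def zDSmul (k : ℤ) (m : A) : ℂ[X] →ₗ[ℂ] A where
  toFun f := ι ℂ (zD k f) • m
  map_add' f g := by rw [zD_add, map_add, add_smul]
  map_smul' t f := by rw [zD_smul, map_smul, smul_assoc, RingHom.id_apply]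

theorem zDSmul_apply (k : ℤ) (m : A) (f : ℂ[X]) : zDSmul k m f = ι ℂ (zD k f) • m := rfl

/-- All the spaces `z⁻ᵏ ℂ[D] m` with `k > 0` are finite-dimensional, in the strong sense that they
are killed by nonzero ideals of `ℂ[D]`. -/
def IsLocallyFiniteVector (m : A) : Prop :=
  ∀ k : ℕ, ∃ f : ℂ[X], f ≠ 0 ∧ ∀ F, f ∣ F → ι ℂ (zD (-(k + 1 : ℤ)) F) • m = 0

theorem comp_X_add_C_ne_zero {f : ℂ[X]} (hf : f ≠ 0) (a : ℂ) : f.comp (X + C a) ≠ 0 := fun h =>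
  hf (by
    have := congrArg (fun p : ℂ[X] => p.comp (X - C a)) h
    beta_reduce at this
    rwa [comp_assoc, add_comp, X_comp, C_comp, sub_add_cancel, comp_X, zero_comp] at this)

omit [Module ℂ A] [IsScalarTower ℂ (UniversalEnvelopingAlgebra ℂ DHat) A] in
-- Commute the two operators. The factor `f₁` kills the reordered product; the commutator has two
-- terms, one with F shifted by -(l + 1) and one with F itself, so both `f₂` and its shift by l + 1
-- are put into F to make each term divisible by `f₂`.
theorem IsLocallyFiniteVector.zD_smul {m : A} (hm : IsLocallyFiniteVector m) (l : ℕ) (h : ℂ[X]) :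
    IsLocallyFiniteVector (ι ℂ (zD (-(l + 1 : ℤ)) h) • m) := by
  intro k
  obtain ⟨f₁, h₁, hf₁⟩ := hm k
  obtain ⟨f₂, h₂, hf₂⟩ := hm (k + l + 1)
  refine ⟨f₁ * f₂ * f₂.comp (X + C (l + 1 : ℂ)),
    mul_ne_zero (mul_ne_zero h₁ h₂) (comp_X_add_C_ne_zero h₂ _), fun F hF => ?_⟩
  obtain ⟨G, rfl⟩ := hF
  rw [ι_smul_ι_smul, zD_lie_zD_of_ne (by omega), hf₁ _ ⟨_, by rw [mul_assoc, mul_assoc]⟩, smul_zero,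
    add_zero, show -(k + 1 : ℤ) + -(l + 1) = -(((k + l + 1 : ℕ) : ℤ) + 1) by push_cast; ring]
  refine hf₂ _ (dvd_sub (Dvd.dvd.mul_right ?_ _) (Dvd.dvd.mul_right ⟨f₁ *
    f₂.comp (X + C (l + 1 : ℂ)) * G, by ring⟩ _))
  rw [mul_comp, mul_comp, comp_assoc f₂]
  refine Dvd.dvd.mul_right (Dvd.dvd.mul_left ?_ _) _
  refine dvd_of_eq ?_
  simp [add_assoc, ← C_add, -map_add]

omit [Module ℂ A] [IsScalarTower ℂ (UniversalEnvelopingAlgebra ℂ DHat) A] in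
theorem IsDescendant.isLocallyFiniteVector {v : A} (hv : IsLocallyFiniteVector v) {n : ℕ} {m : A}
    (h : IsDescendant v n m) : IsLocallyFiniteVector m := by
  induction h with
  | refl => exact hv
  | step k f n m _ ih => exact ih.zD_smul k f

theorem isLocallyFiniteVector_of_mem_descendants {v : A} (hv : IsLocallyFiniteVector v) {n : ℕ}
    {m : A} (h : m ∈ descendants v n) : IsLocallyFiniteVector m := by
  induction h using Submodule.span_induction with
  | mem m hm => exact IsDescendant.isLocallyFiniteVector hv hm
  | zero => exact fun k => ⟨1, one_ne_zero, fun F _ => smul_zero _⟩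
  | add m m' _ _ hm hm' =>
    intro k
    obtain ⟨f, hf, h⟩ := hm k
    obtain ⟨f', hf', h'⟩ := hm' k
    exact ⟨f * f', mul_ne_zero hf hf', fun F hF => by
      rw [smul_add, h F (dvd_of_mul_right_dvd hF), h' F (dvd_of_mul_left_dvd hF), add_zero]⟩
  | smul t m _ hm =>
    intro k
    obtain ⟨f, hf, h⟩ := hm k
    exact ⟨f, hf, fun F hF => by rw [smul_comm, h F hF, smul_zero]⟩

theorem finiteDimensional_range_of_dvd {V : Type*} [AddCommGroup V] [Module ℂ V]
    (T : ℂ[X] →ₗ[ℂ] V) {f : ℂ[X]} (hf : f ≠ 0) (hT : ∀ F, f ∣ F → T F = 0) :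
    FiniteDimensional ℂ (LinearMap.range T) := by
  have h : LinearMap.range T ≤ (degreeLT ℂ f.natDegree).map T := by
    rintro _ ⟨F, rfl⟩
    refine ⟨F % f, mem_degreeLT.mpr ?_, ?_⟩
    · rw [← degree_eq_natDegree hf]
      exact EuclideanDomain.mod_lt F hf
    · conv_rhs => rw [← EuclideanDomain.div_add_mod F f, map_add, hT _ (dvd_mul_right _ _),
        zero_add]
  have : FiniteDimensional ℂ (degreeLT ℂ f.natDegree) :=
    Module.Finite.equiv (degreeLTEquiv ℂ f.natDegree).symm
  exact Submodule.finiteDimensional_of_le h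

/-- Besides v itself, the descendants of degree -n come from applying operators of degree -(n - i)
to descendants of degree -i with i < n. These form a finite-dimensional space, and on each vector of
a finite spanning set the operators have finite-dimensional range. -/
theorem finiteDimensional_descendants {v : A} (hv : IsLocallyFiniteVector v) (n : ℕ) :
    FiniteDimensional ℂ (descendants v n) := by
  induction n using Nat.strong_induction_on with
  | _ n ih =>
    have hstep : ∀ i : Fin n, ∃ S : Submodule ℂ A, FiniteDimensional ℂ S ∧
        ∀ f, ∀ m ∈ descendants v i, ι ℂ (zD (-((n - i - 1 : ℕ) + 1 : ℤ)) f) • m ∈ S := by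
      intro i
      obtain ⟨s, hs⟩ := (Submodule.fg_iff_finiteDimensional _).mpr (ih i i.2)
      refine ⟨⨆ w : s, LinearMap.range (zDSmul (-((n - i - 1 : ℕ) + 1 : ℤ)) (w : A)), ?_,
        fun f m hm => ?_⟩
      · have : ∀ w : s, FiniteDimensional ℂ
            (LinearMap.range (zDSmul (-((n - i - 1 : ℕ) + 1 : ℤ)) (w : A))) := fun w => by
          obtain ⟨f, hf, h⟩ := isLocallyFiniteVector_of_mem_descendants hv (n := i)
            (hs ▸ Submodule.subset_span w.2 : (w : A) ∈ descendants v i) (n - i - 1)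
          exact finiteDimensional_range_of_dvd _ hf h
        exact Submodule.finiteDimensional_iSup _
      · rw [← hs] at hm
        induction hm using Submodule.span_induction with
        | mem w hw => exact Submodule.mem_iSup_of_mem ⟨w, hw⟩ ⟨f, rfl⟩
        | zero => rw [smul_zero]; exact Submodule.zero_mem _
        | add m m' _ _ hm hm' => rw [smul_add]; exact Submodule.add_mem _ hm hm'
        | smul t m _ hm => rw [smul_comm]; exact Submodule.smul_mem _ t hm
    choose S hS hmem using hstep
    have hle : descendants v n ≤ (ℂ ∙ v) ⊔ ⨆ i, S i := by
      refine Submodule.span_le.mpr fun m hm => ?_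
      cases hm with
      | refl => exact Submodule.mem_sup_left (Submodule.mem_span_singleton_self v)
      | step k f i m h =>
        refine Submodule.mem_sup_right (Submodule.mem_iSup_of_mem ⟨i, by omega⟩ ?_)
        have := hmem ⟨i, by omega⟩ f m (Submodule.subset_span h)
        rwa [show i + k + 1 - i - 1 = k by omega] at this
    have : FiniteDimensional ℂ (⨆ i, S i : Submodule ℂ A) := Submodule.finiteDimensional_iSup _
    exact Submodule.finiteDimensional_of_le hle

/-- If `z⁻¹ b(D) ℂ[D]` kills `v`, then `z⁻ᵏ b(D) b(D - 1) ⋯ b(D - k + 1) ℂ[D]` kills `v`. -/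
theorem zD_prod_smul_eq_zero {v : A} {b : ℂ[X]}
    (hb : ∀ g, ι ℂ (zD (-1) (b * g)) • v = 0) (k : ℕ) (g : ℂ[X]) :
    ι ℂ (zD (-(k + 1 : ℤ)) ((∏ i ∈ Finset.range (k + 1), b.comp (X + C (-(i : ℂ)))) * g)) • v
      = 0 := by
  induction k generalizing g with
  | zero => simpa using hb g
  | succ k ih =>
    set B := ∏ i ∈ Finset.range (k + 1), b.comp (X + C (-(i : ℂ))) with hB
    set B' := ∏ i ∈ Finset.range (k + 1 + 1), b.comp (X + C (-(i : ℂ))) with hB'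
    have h1 : B' = b.comp (X + C (-(k + 1 : ℂ))) * B := by
      rw [hB', Finset.prod_range_succ, mul_comm]; push_cast; rfl
    have h2 : B' = b * B.comp (X + C (-1 : ℂ)) := by
      rw [hB', Finset.prod_range_succ', mul_comm, hB, prod_comp]
      congr 1
      · simp
      · refine Finset.prod_congr rfl fun i _ => ?_
        rw [comp_assoc]
        congr 1
        simp only [add_comp, X_comp, C_comp, add_assoc, ← C_add]
        push_cast
        ring_nf
    -- Bracket two operators which already kill v. By `h1` and `h2` each term of the commutator
    -- contains `B'` as a factor.
    have key : ∀ g h : ℂ[X], zDSmul (-((k + 1 : ℕ) + 1 : ℤ)) v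
        (B' * (g.comp (X + C (-(k + 1 : ℂ))) * h - g * h.comp (X + C (-1 : ℂ)))) = 0 := by
      intro g h
      have h3 := ι_smul_ι_smul (zD (-1) (b * g)) (zD (-(k + 1 : ℤ)) (B * h)) v
      rw [hb g, ih h, smul_zero, smul_zero, add_zero, zD_lie_zD_of_ne (by omega)] at h3
      rw [zDSmul_apply, h3]
      congr 3
      · push_cast; ring
      · rw [mul_sub]
        congr 1
        · rw [h1, mul_comp]; push_cast; ring
        · rw [h2, mul_comp]; push_cast; ring
    -- The pairs (X, g), (1, X g) and (1, g) are chosen so that the first expression minus the other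
    -- two is -(k + 2) B' g: the shifted copies of g cancel.
    have h4 := key X g
    have h5 := key 1 (X * g)
    have h6 := key 1 g
    have e : B' * g = (-(k + 2 : ℂ)⁻¹) •
        (B' * (X.comp (X + C (-(k + 1 : ℂ))) * g - X * g.comp (X + C (-1 : ℂ))) -
        B' * ((1 : ℂ[X]).comp (X + C (-(k + 1 : ℂ))) * (X * g) -
          1 * (X * g).comp (X + C (-1 : ℂ))) -
        B' * ((1 : ℂ[X]).comp (X + C (-(k + 1 : ℂ))) * g - 1 * g.comp (X + C (-1 : ℂ)))) := by
      have hk : (k + 2 : ℂ) ≠ 0 := by exact_mod_cast (by omega : k + 2 ≠ 0)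
      rw [neg_smul, ← smul_neg, eq_inv_smul_iff₀ hk, smul_eq_C_mul]
      simp only [X_comp, one_comp, mul_comp, map_neg, map_add, map_one, map_ofNat]
      ring
    rw [← zDSmul_apply, e, map_smul, map_sub, map_sub, h4, h5, h6]
    simp

theorem isLocallyFiniteVector_of_zD_smul_eq_zero {v : A} {b : ℂ[X]} (hb0 : b ≠ 0)
    (hb : ∀ g, ι ℂ (zD (-1) (b * g)) • v = 0) : IsLocallyFiniteVector v := fun k =>
  ⟨_, Finset.prod_ne_zero_iff.mpr fun i _ => comp_X_add_C_ne_zero hb0 _, fun F hF => by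
    obtain ⟨g, rfl⟩ := hF
    exact zD_prod_smul_eq_zero hb k g⟩

end Annihilator

end DHat

/-! ### The functional ν and the criterion of quasifiniteness. -/

namespace DHat

open HighestWeight UniversalEnvelopingAlgebra

variable (lam : Module.Dual ℂ (grade 0))

/-- The functional `h ↦ lam (h(D) - h(D + 1)) + lam(C) h(0)`, which computes the values of `lam` on
the brackets of elements of degrees `1` and `-1`. -/
def bracketFunctional : Module.Dual ℂ ℂ[X] where
  toFun h := extendByZero lam (zD 0 (h - h.comp (X + C 1))) + h.eval 0 * extendByZero lam central
  map_add' h h' := by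
    rw [add_comp, add_sub_add_comm, zD_add, map_add, eval_add]
    ring
  map_smul' t h := by
    rw [smul_comp, ← smul_sub, zD_smul, map_smul, eval_smul, RingHom.id_apply]
    simp only [smul_eq_mul]
    ring

theorem bracketFunctional_apply (h : ℂ[X]) : bracketFunctional lam h =
    extendByZero lam (zD 0 (h - h.comp (X + C 1))) + h.eval 0 * extendByZero lam central := rfl

/-- With h = f(D - 1) g(D), the commutator is h(D) - h(D + 1) and the cocycle f(-1) g(0) is h(0). -/
theorem extendByZero_zD_lie_zD (f g : ℂ[X]) :
    extendByZero lam ⁅zD 1 f, zD (-1) g⁆ = bracketFunctional lam (f.comp (X + C (-1)) * g) := by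
  have h1 : (f.comp (X + C (-1 : ℂ))).comp (X + C 1) = f := by
    rw [comp_assoc, add_comp, X_comp, C_comp, add_assoc, ← C_add, add_neg_cancel, C_0, add_zero,
      comp_X]
  have h2 : monoCocycle 1 f (-1) g = (f.comp (X + C (-1 : ℂ)) * g).eval 0 := by
    have : Finset.Ico (-1 : ℤ) 0 = {-1} := rfl
    simp [monoCocycle, signedSum, this]
  rw [zD_lie_zD, map_add, map_smul, bracketFunctional_apply, mul_comp, h1, h2, smul_eq_mul]
  simp

/-- The space of all z⁻¹ b(D) g(D) v is stable under nonnegative degrees: degree 0 preserves the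
ideal (b), degree 1 gives the scalars ν(h) with b dividing h, and higher degrees give brackets of
positive degree, which kill v. Hence the submodule it generates stays inside the kernel of ε. -/
theorem apply_smul_zD_smul_eq_zero {A : Type*} [AddCommGroup A] [Module ℂ A]
    [Module (UniversalEnvelopingAlgebra ℂ DHat) A]
    [IsScalarTower ℂ (UniversalEnvelopingAlgebra ℂ DHat) A] {v : A}
    (hv : IsHighestWeightVector lam v) (ε : A →ₗ[ℂ] ℂ)
    (hε : ∀ j < 0, ∀ y ∈ grade j, ∀ m, ε (ι ℂ y • m) = 0) {b : ℂ[X]}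
    (hb : ∀ h, b ∣ h → bracketFunctional lam h = 0) (g : ℂ[X])
    (a : UniversalEnvelopingAlgebra ℂ DHat) : ε (a • ι ℂ (zD (-1) (b * g)) • v) = 0 := by
  let W : Submodule ℂ A := LinearMap.range (zDSmul (-1) v ∘ₗ LinearMap.mulLeft ℂ b)
  have hW : ∀ g, ι ℂ (zD (-1) (b * g)) • v ∈ W := fun g => ⟨g, rfl⟩
  refine smul_mem_of_negative_stable W (LinearMap.ker ε) (fun j hj x hx w hw => ?_) ?_
    (fun j hj x hx m _ => hε j hj x hx m) a (hW g)
  · obtain ⟨g, rfl⟩ := hw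
    change ι ℂ x • ι ℂ (zD (-1) (b * g)) • v ∈ W
    rw [ι_smul_ι_smul, hv j hj x hx, smul_comm]
    refine W.add_mem ?_ (W.smul_mem _ (hW g))
    rcases hj.eq_or_lt with rfl | hj
    · rw [eq_zD_add_of_mem_grade_zero hx, add_lie, smul_lie, central_lie, smul_zero, add_zero,
        zD_lie_zD_of_ne (by norm_num)]
      have e : (x.1 0).comp (X + C ((-1 : ℤ) : ℂ)) * (b * g) -
          x.1 0 * (b * g).comp (X + C ((0 : ℤ) : ℂ)) =
          b * ((x.1 0).comp (X + C ((-1 : ℤ) : ℂ)) * g - x.1 0 * g) := by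
        simp only [Int.cast_zero, C_0, add_zero, comp_X]
        ring
      rw [e]
      exact hW _
    · have hlie := lie_mem_grade hx (zD_mem_grade (-1) (b * g))
      rw [hv (j + -1) (by omega) _ hlie]
      suffices extendByZero lam ⁅x, zD (-1) (b * g)⁆ = 0 by
        rw [this, zero_smul]; exact W.zero_mem
      by_cases h1 : j = 1
      · subst h1
        rw [eq_zD_of_mem_grade one_ne_zero hx, extendByZero_zD_lie_zD]
        exact hb _ ((dvd_mul_right b g).mul_left _)
      · exact extendByZero_of_supportedIn (S := Set.Ioi 0) lam Set.self_notMem_Ioi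
          (grade_le_supportedIn (Set.mem_Ioi.mpr (by omega)) hlie)
  · rintro _ ⟨g, rfl⟩
    exact hε (-1) (by norm_num) _ (zD_mem_grade _ _) _

theorem zD_smul_vermaVector_mem {b : ℂ[X]}
    (hb : ∀ h, b ∣ h → bracketFunctional lam h = 0) (g : ℂ[X]) :
    ι ℂ (zD (-1) (b * g)) • vermaVector lam ∈ maximalGradedSubmodule grade lam := by
  obtain ⟨ε, -, hn, -, hmax⟩ := exists_functional_maximalGradedSubmodule lam
  exact hmax (-1 + 0) _
    (ι_smul_mem_vermaGrade lam (zD_mem_grade _ _) (vermaVector_mem_vermaGrade lam))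
    (apply_smul_zD_smul_eq_zero lam (isHighestWeightVector_vermaVector lam) ε hn hb g)

theorem smul_irreducibleVector (a : UniversalEnvelopingAlgebra ℂ DHat) :
    a • irreducibleVector lam =
      (maximalGradedSubmodule grade lam).mkQ (a • vermaVector lam) :=
  ((maximalGradedSubmodule grade lam).mkQ.map_smul a _).symm

theorem smul_irreducibleVector_eq_zero_iff (a : UniversalEnvelopingAlgebra ℂ DHat) :
    a • irreducibleVector lam = 0 ↔ a • vermaVector lam ∈ maximalGradedSubmodule grade lam := by
  rw [smul_irreducibleVector, Submodule.mkQ_apply, Submodule.Quotient.mk_eq_zero]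

theorem zD_smul_irreducibleVector_mem (k : ℤ) (f : ℂ[X]) :
    ι ℂ (zD k f) • irreducibleVector lam ∈ irreducibleGrade grade lam k := by
  rw [smul_irreducibleVector]
  refine Submodule.mem_map_of_mem (f := (maximalGradedSubmodule grade lam).mkQ.restrictScalars ℂ) ?_
  simpa using ι_smul_mem_vermaGrade lam (zD_mem_grade k f) (vermaVector_mem_vermaGrade lam)

/-- The infinite-dimensional space ℂ[X] cannot embed in a finite-dimensional component. -/
theorem exists_zD_smul_irreducibleVector_eq_zero
    (h : FiniteDimensional ℂ (irreducibleGrade grade lam (-1))) :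
    ∃ b : ℂ[X], b ≠ 0 ∧ ι ℂ (zD (-1) b) • irreducibleVector lam = 0 := by
  have hni : ¬ Function.Injective ((zDSmul (-1) (irreducibleVector lam)).codRestrict _
      (zD_smul_irreducibleVector_mem lam (-1))) := fun hi =>
    Polynomial.not_finite (R := ℂ) (Module.Finite.of_injective _ hi)
  rw [← LinearMap.ker_eq_bot, Submodule.eq_bot_iff] at hni
  push Not at hni
  obtain ⟨b, hb, hb0⟩ := hni
  exact ⟨b, hb0, congrArg Subtype.val hb⟩

theorem bracketFunctional_eq_zero_of_dvd {b : ℂ[X]}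
    (hb : ι ℂ (zD (-1) b) • irreducibleVector lam = 0) {h : ℂ[X]} (hbh : b ∣ h) :
    bracketFunctional lam h = 0 := by
  obtain ⟨g, hg⟩ := hbh
  obtain ⟨ε, h1, -, hker, -⟩ := exists_functional_maximalGradedSubmodule lam
  have hv := isHighestWeightVector_vermaVector lam
  rw [smul_irreducibleVector_eq_zero_iff] at hb
  -- Returning to degree 0 yields a multiple of the generator lying in the maximal submodule, so the
  -- scalar is 0. The shift of g by 1 offsets the f(D - 1) in the bracket formula, and the scalar is
  -- ν(g b).
  have h2 := hker _ ((maximalGradedSubmodule grade lam).smul_mem (ι ℂ (zD 1 (g.comp (X + C 1)))) hb)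
  have hlie := lie_mem_grade (zD_mem_grade 1 (g.comp (X + C 1))) (zD_mem_grade (-1) b)
  have h3 : extendByZero lam (zD 1 (g.comp (X + C 1))) = 0 :=
    extendByZero_of_supportedIn (S := Set.Ioi 0) lam Set.self_notMem_Ioi
      (grade_le_supportedIn (Set.mem_Ioi.mpr one_pos) (zD_mem_grade _ _))
  have h4 : (g.comp (X + C (1 : ℂ))).comp (X + C (-1)) = g := by
    rw [comp_assoc, add_comp, X_comp, C_comp, add_assoc, ← C_add, neg_add_cancel, C_0, add_zero,
      comp_X]
  rw [ι_smul_ι_smul, hv 1 zero_le_one _ (zD_mem_grade _ _), h3, zero_smul, smul_zero, add_zero,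
    hv (1 + -1) (by norm_num) _ hlie, map_smul, h1, extendByZero_zD_lie_zD, smul_eq_mul, mul_one,
    h4, mul_comm] at h2
  rw [hg, h2]

/-- The criterion of quasifiniteness in terms of the characteristic polynomial `b`. -/
theorem isQuasifinite_iff : IsQuasifinite (irreducibleGrade grade lam) ↔
    ∃ b : ℂ[X], b ≠ 0 ∧ ∀ h, b ∣ h → bracketFunctional lam h = 0 := by
  constructor
  · intro hq
    -- Finite dimension in degree -1 alone already gives b.
    obtain ⟨b, hb0, hb⟩ := exists_zD_smul_irreducibleVector_eq_zero lam (hq (-1))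
    exact ⟨b, hb0, fun h => bracketFunctional_eq_zero_of_dvd lam hb⟩
  · rintro ⟨b, hb0, hb⟩ j
    have hv : ∀ g, ι ℂ (zD (-1) (b * g)) • irreducibleVector lam = 0 := fun g =>
      (smul_irreducibleVector_eq_zero_iff lam _).mpr (zD_smul_vermaVector_mem lam hb g)
    have hfin := finiteDimensional_descendants (isLocallyFiniteVector_of_zD_smul_eq_zero hb0 hv)
    have hle := irreducibleGrade_le_weightSpace lam j
    rw [weightSpace_eq (isHighestWeightVector_irreducibleVector lam)
      (exists_eq_smul_irreducibleVector lam)] at hle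
    split_ifs at hle with h
    · have := hfin j.natAbs
      exact Submodule.finiteDimensional_of_le hle
    · exact Submodule.finiteDimensional_of_le hle

end DHat

/-! ### Quasipolynomials and linear differential equations with constant coefficients. -/

theorem exists_derivative_add_smul_eq (γ : ℂ) (p : ℂ[X]) :
    ∃ q : ℂ[X], derivative q + γ • q = p := by
  have hX : ∀ n : ℕ, ∃ q : ℂ[X], derivative q + γ • q = X ^ n := by
    by_cases hγ : γ = 0
    · intro n
      refine ⟨((n + 1 : ℂ)⁻¹) • X ^ (n + 1), ?_⟩
      have hn : (n + 1 : ℂ) ≠ 0 := Nat.cast_add_one_ne_zero n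
      rw [hγ, zero_smul, add_zero, derivative_smul, derivative_X_pow, Nat.add_sub_cancel,
        inv_smul_eq_iff₀ hn, smul_eq_C_mul]
      push_cast
      rfl
    · intro n
      induction n with
      | zero => exact ⟨γ⁻¹ • 1, by simp [smul_smul, hγ]⟩
      | succ n ih =>
        obtain ⟨q, hq⟩ := ih
        -- Integration by parts: the derivative of this polynomial is (n + 1) q, which cancels the
        -- correction term.
        refine ⟨γ⁻¹ • (X ^ (n + 1) - (n + 1 : ℂ) • q), ?_⟩
        have h : derivative q = X ^ n - γ • q := eq_sub_of_add_eq hq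
        rw [smul_inv_smul₀ hγ, derivative_smul, derivative_sub, derivative_smul, h,
          derivative_X_pow, Nat.add_sub_cancel, smul_sub (n + 1 : ℂ), smul_comm (n + 1 : ℂ) γ q,
          show C ((n + 1 : ℕ) : ℂ) * X ^ n = (n + 1 : ℂ) • X ^ n by
            rw [smul_eq_C_mul]; push_cast; rfl,
          sub_sub_cancel, inv_smul_smul₀ hγ]
        abel
  induction p using Polynomial.induction_on' with
  | add p p' hp hp' =>
    obtain ⟨q, hq⟩ := hp
    obtain ⟨q', hq'⟩ := hp'
    exact ⟨q + q', by rw [derivative_add, smul_add, ← hq, ← hq']; abel⟩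
  | monomial n t =>
    obtain ⟨q, hq⟩ := hX n
    refine ⟨t • q, ?_⟩
    rw [derivative_smul, smul_comm γ t, ← smul_add, hq, smul_X_eq_monomial]

namespace PowerSeries

/-- The derivation `d/dx` as an endomorphism. -/
def derivativeEnd : Module.End ℂ (PowerSeries ℂ) := (derivative ℂ).toLinearMap

theorem coeff_derivativeEnd (f : PowerSeries ℂ) (n : ℕ) :
    coeff n (derivativeEnd f) = coeff (n + 1) f * (n + 1) := coeff_derivative f n

theorem coeff_rescale_exp (α : ℂ) (n : ℕ) :
    coeff n (rescale α (exp ℂ)) = α ^ n / (n.factorial : ℂ) := by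
  simp [coeff_rescale, coeff_exp, div_eq_mul_inv]

theorem derivativeEnd_rescale_exp (α : ℂ) :
    derivativeEnd (rescale α (exp ℂ)) = α • rescale α (exp ℂ) := by
  ext n
  rw [coeff_derivativeEnd, coeff_smul, coeff_rescale_exp, coeff_rescale_exp, smul_eq_mul,
    Nat.factorial_succ]
  have h1 : (n + 1 : ℂ) ≠ 0 := Nat.cast_add_one_ne_zero n
  have h2 : (n.factorial : ℂ) ≠ 0 := Nat.cast_ne_zero.mpr n.factorial_ne_zero
  push_cast
  field_simp
  ring

theorem derivativeEnd_coe_mul_rescale_exp (p : ℂ[X]) (α : ℂ) :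
    derivativeEnd ((p : PowerSeries ℂ) * rescale α (exp ℂ)) =
      ((Polynomial.derivative p + α • p : ℂ[X]) : PowerSeries ℂ) * rescale α (exp ℂ) := by
  have h : derivativeEnd ((p : PowerSeries ℂ) * rescale α (exp ℂ)) =
      (p : PowerSeries ℂ) • derivativeEnd (rescale α (exp ℂ)) +
        rescale α (exp ℂ) • derivativeEnd (p : PowerSeries ℂ) := Derivation.leibniz _ _ _
  have h' : derivativeEnd (p : PowerSeries ℂ) = Polynomial.derivative p := derivative_coe p
  rw [h, h', derivativeEnd_rescale_exp, Polynomial.coe_add, Polynomial.coe_smul, smul_eq_mul,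
    smul_eq_mul, add_mul, mul_smul_comm, smul_mul_assoc, add_comm, mul_comm]

theorem eq_smul_rescale_exp {φ : PowerSeries ℂ} {α : ℂ} (h : derivativeEnd φ = α • φ) :
    φ = constantCoeff φ • rescale α (exp ℂ) := by
  ext n
  rw [coeff_smul, coeff_rescale_exp, smul_eq_mul]
  induction n with
  | zero => simp
  | succ n ih =>
    have h1 := congrArg (coeff n) h
    rw [coeff_derivativeEnd, coeff_smul, ih, smul_eq_mul] at h1
    have h2 : (n + 1 : ℂ) ≠ 0 := Nat.cast_add_one_ne_zero n
    have h3 : (n.factorial : ℂ) ≠ 0 := Nat.cast_ne_zero.mpr n.factorial_ne_zero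
    rw [eq_div_of_mul_eq h2 h1, Nat.factorial_succ]
    push_cast
    field_simp
    ring

end PowerSeries

open PowerSeries (derivativeEnd)

theorem isQuasipolynomial_coe_mul (p : ℂ[X]) (α : ℂ) :
    IsQuasipolynomial ((p : PowerSeries ℂ) * PowerSeries.rescale α (PowerSeries.exp ℂ)) :=
  Submodule.subset_span ⟨p, α, rfl⟩

/-- On q(x) e^{βx} the operator d/dx - α acts as q ↦ q' + (β - α) q, which is surjective on
polynomials, including the resonant case β = α. -/
theorem IsQuasipolynomial.exists_derivativeEnd_sub {ψ : PowerSeries ℂ} (hψ : IsQuasipolynomial ψ)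
    (α : ℂ) : ∃ φ, IsQuasipolynomial φ ∧ derivativeEnd φ - α • φ = ψ := by
  induction hψ using Submodule.span_induction with
  | mem ψ hψ =>
    obtain ⟨p, β, rfl⟩ := hψ
    obtain ⟨q, hq⟩ := exists_derivative_add_smul_eq (β - α) p
    refine ⟨_, isQuasipolynomial_coe_mul q β, ?_⟩
    rw [PowerSeries.derivativeEnd_coe_mul_rescale_exp, ← smul_mul_assoc, ← sub_mul,
      ← Polynomial.coe_smul, ← Polynomial.coe_sub, add_sub_assoc, ← sub_smul, hq]
  | zero => exact ⟨0, Submodule.zero_mem _, by rw [map_zero, smul_zero, sub_zero]⟩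
  | add ψ ψ' _ _ h h' =>
    obtain ⟨φ, hφ, rfl⟩ := h
    obtain ⟨φ', hφ', rfl⟩ := h'
    exact ⟨φ + φ', Submodule.add_mem _ hφ hφ', by rw [map_add, smul_add]; abel⟩
  | smul t ψ _ h =>
    obtain ⟨φ, hφ, rfl⟩ := h
    exact ⟨t • φ, Submodule.smul_mem _ t hφ, by rw [map_smul, smul_sub, smul_comm t α]⟩

/-- The quasipolynomials are the solutions of linear differential equations with constant
coefficients. -/
theorem isQuasipolynomial_iff (φ : PowerSeries ℂ) :
    IsQuasipolynomial φ ↔ ∃ b : ℂ[X], b ≠ 0 ∧ aeval derivativeEnd b φ = 0 := by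
  constructor
  · intro hφ
    induction hφ using Submodule.span_induction with
    | mem φ hφ =>
      obtain ⟨p, α, rfl⟩ := hφ
      -- Each factor d/dx - α differentiates p once, so one more than the degree is enough.
      refine ⟨(X - C α) ^ (p.natDegree + 1), pow_ne_zero _ (X_sub_C_ne_zero α), ?_⟩
      have h : ∀ n : ℕ, aeval derivativeEnd ((X - C α) ^ n)
          ((p : PowerSeries ℂ) * PowerSeries.rescale α (PowerSeries.exp ℂ)) =
          ((derivative^[n] p : ℂ[X]) : PowerSeries ℂ) *
            PowerSeries.rescale α (PowerSeries.exp ℂ) := by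
        intro n
        induction n with
        | zero => simp
        | succ n ih =>
          rw [pow_succ', map_mul (aeval derivativeEnd), Module.End.mul_apply, ih, map_sub, aeval_X,
            aeval_C,
            LinearMap.sub_apply, PowerSeries.derivativeEnd_coe_mul_rescale_exp,
            Module.algebraMap_end_apply, ← smul_mul_assoc, ← sub_mul, ← Polynomial.coe_smul,
            ← Polynomial.coe_sub, add_sub_cancel_right, Function.iterate_succ_apply']
      rw [h, iterate_derivative_eq_zero (Nat.lt_succ_self _), Polynomial.coe_zero, zero_mul]
    | zero => exact ⟨1, one_ne_zero, map_zero _⟩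
    | add φ φ' _ _ h h' =>
      obtain ⟨b, hb0, hb⟩ := h
      obtain ⟨b', hb0', hb'⟩ := h'
      refine ⟨b * b', mul_ne_zero hb0 hb0', ?_⟩
      rw [map_add, map_mul (aeval derivativeEnd), Module.End.mul_apply, Module.End.mul_apply, hb',
        map_zero, add_zero, ← Module.End.mul_apply, ← map_mul, mul_comm,
        map_mul (aeval derivativeEnd), Module.End.mul_apply, hb, map_zero]
    | smul t φ _ h =>
      obtain ⟨b, hb0, hb⟩ := h
      exact ⟨b, hb0, by rw [map_smul, hb, smul_zero]⟩
  · rintro ⟨b, hb0, hb⟩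
    induction hd : b.natDegree generalizing b φ with
    | zero =>
      obtain ⟨t, rfl⟩ := natDegree_eq_zero.mp hd
      rw [aeval_C, Module.algebraMap_end_apply,
        smul_eq_zero_iff_right (fun h => hb0 (by rw [h, C_0]))] at hb
      exact hb ▸ Submodule.zero_mem _
    | succ n ih =>
      obtain ⟨α, hα⟩ := IsAlgClosed.exists_root b (by
        rw [degree_eq_natDegree hb0, hd]; exact_mod_cast Nat.succ_ne_zero n)
      obtain ⟨b', rfl⟩ := dvd_iff_isRoot.mpr hα
      have hb0' : b' ≠ 0 := right_ne_zero_of_mul hb0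
      rw [natDegree_mul (X_sub_C_ne_zero α) hb0', natDegree_X_sub_C] at hd
      rw [mul_comm, map_mul, Module.End.mul_apply, map_sub, aeval_X, aeval_C,
        LinearMap.sub_apply, Module.algebraMap_end_apply] at hb
      -- By induction (d/dx - α) φ is a quasipolynomial. Lifting it to a quasipolynomial χ leaves a
      -- difference φ - χ killed by d/dx - α, a multiple of e^{αx}.
      obtain ⟨χ, hχ, h⟩ := (ih _ b' hb0' hb (by omega)).exists_derivativeEnd_sub α
      have hker : derivativeEnd (φ - χ) = α • (φ - χ) := by
        rw [map_sub, smul_sub, sub_eq_sub_iff_sub_eq_sub, ← h]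
      have := PowerSeries.eq_smul_rescale_exp hker
      rw [← sub_add_cancel φ χ, this]
      refine Submodule.add_mem _ (Submodule.smul_mem _ _ ?_) hχ
      have := isQuasipolynomial_coe_mul 1 α
      rwa [Polynomial.coe_one, one_mul] at this

/-! ### Exponential generating series of functionals on polynomials. -/

/-- The exponential generating series `∑ₙ ν(Xⁿ) xⁿ / n!` of a functional on polynomials. -/
def egf (ν : Module.Dual ℂ ℂ[X]) : PowerSeries ℂ :=
  PowerSeries.mk fun n => ν (X ^ n) / (n.factorial : ℂ)

theorem coeff_egf (ν : Module.Dual ℂ ℂ[X]) (n : ℕ) :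
    PowerSeries.coeff n (egf ν) = ν (X ^ n) / (n.factorial : ℂ) := PowerSeries.coeff_mk _ _

theorem egf_add (ν ν' : Module.Dual ℂ ℂ[X]) : egf (ν + ν') = egf ν + egf ν' := by
  ext n
  rw [map_add, coeff_egf, coeff_egf, coeff_egf, LinearMap.add_apply, add_div]

theorem egf_smul (t : ℂ) (ν : Module.Dual ℂ ℂ[X]) : egf (t • ν) = t • egf ν := by
  ext n
  rw [PowerSeries.coeff_smul, coeff_egf, coeff_egf, LinearMap.smul_apply, smul_eq_mul, smul_eq_mul,
    mul_div_assoc]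

theorem egf_eq_zero_iff (ν : Module.Dual ℂ ℂ[X]) : egf ν = 0 ↔ ν = 0 := by
  constructor
  · intro h
    ext n
    have h1 := congrArg (PowerSeries.coeff n) h
    rw [coeff_egf, map_zero, div_eq_zero_iff] at h1
    simpa [← X_pow_eq_monomial] using
      h1.resolve_right (Nat.cast_ne_zero.mpr n.factorial_ne_zero)
  · rintro rfl
    ext n
    rw [coeff_egf, LinearMap.zero_apply, zero_div, map_zero]

theorem derivativeEnd_egf (ν : Module.Dual ℂ ℂ[X]) :
    derivativeEnd (egf ν) = egf (ν ∘ₗ LinearMap.mulLeft ℂ X) := by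
  ext n
  rw [PowerSeries.coeff_derivativeEnd, coeff_egf, coeff_egf, LinearMap.comp_apply,
    LinearMap.mulLeft_apply, ← pow_succ', Nat.factorial_succ]
  have h2 : (n + 1 : ℂ) ≠ 0 := Nat.cast_add_one_ne_zero n
  have h3 : (n.factorial : ℂ) ≠ 0 := Nat.cast_ne_zero.mpr n.factorial_ne_zero
  push_cast
  field_simp

/-- Since d/dx is dual to multiplication by X, a differential equation for the series says that the
functional vanishes on the ideal generated by its characteristic polynomial. -/
theorem aeval_derivativeEnd_egf (b : ℂ[X]) (ν : Module.Dual ℂ ℂ[X]) :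
    aeval derivativeEnd b (egf ν) = egf (ν ∘ₗ LinearMap.mulLeft ℂ b) := by
  induction b using Polynomial.induction_on generalizing ν with
  | C t =>
    rw [aeval_C, Module.algebraMap_end_apply, ← egf_smul]
    congr 1
    ext n
    simp [← smul_eq_C_mul]
  | add p q hp hq =>
    rw [map_add, LinearMap.add_apply, hp, hq, ← egf_add]
    congr 1
    ext n
    simp [add_mul]
  | monomial n t h =>
    rw [pow_succ, ← mul_assoc, map_mul, Module.End.mul_apply, aeval_X, derivativeEnd_egf, h]
    congr 1
    ext n
    simp only [LinearMap.comp_apply, LinearMap.mulLeft_apply]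
    congr 1
    ring

/-- The generating series of a functional is a quasipolynomial if and only if the functional
vanishes on a nonzero ideal. -/
theorem isQuasipolynomial_egf_iff (ν : Module.Dual ℂ ℂ[X]) :
    IsQuasipolynomial (egf ν) ↔ ∃ b : ℂ[X], b ≠ 0 ∧ ∀ h, b ∣ h → ν h = 0 := by
  rw [isQuasipolynomial_iff]
  refine exists_congr fun b => and_congr_right fun _ => ?_
  rw [aeval_derivativeEnd_egf, egf_eq_zero_iff]
  constructor
  · rintro h _ ⟨g, rfl⟩
    exact congrArg (fun μ : Module.Dual ℂ ℂ[X] => μ g) h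
  · intro h
    exact LinearMap.ext fun g => h _ (dvd_mul_right b g)

/-- Multiplication by `eˣ` of generating series corresponds to the shift of polynomials. -/
theorem exp_mul_egf (ν : Module.Dual ℂ ℂ[X]) :
    PowerSeries.exp ℂ * egf ν = egf (ν ∘ₗ (aeval (X + C 1 : ℂ[X])).toLinearMap) := by
  ext n
  rw [PowerSeries.coeff_mul, coeff_egf, LinearMap.comp_apply, AlgHom.toLinearMap_apply, map_pow,
    aeval_X, C_1, add_comm, (Commute.one_left (X : ℂ[X])).add_pow', map_sum, Finset.sum_div]
  refine Finset.sum_congr rfl fun p hp => ?_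
  obtain rfl := Finset.HasAntidiagonal.mem_antidiagonal.mp hp
  rw [coeff_egf, PowerSeries.coeff_exp, one_pow, one_mul, map_nsmul, nsmul_eq_mul,
    Nat.cast_add_choose ℂ]
  have h1 : (p.1.factorial : ℂ) ≠ 0 := Nat.cast_ne_zero.mpr p.1.factorial_ne_zero
  have h2 : (p.2.factorial : ℂ) ≠ 0 := Nat.cast_ne_zero.mpr p.2.factorial_ne_zero
  have h3 : ((p.1 + p.2).factorial : ℂ) ≠ 0 := Nat.cast_ne_zero.mpr (p.1 + p.2).factorial_ne_zero
  simp only [map_div₀, map_one, map_natCast]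
  field_simp

theorem isQuasipolynomial_C (c : ℂ) : IsQuasipolynomial (PowerSeries.C c) := by
  have h := isQuasipolynomial_coe_mul (C c) 0
  rwa [PowerSeries.rescale_zero, RingHom.comp_apply, PowerSeries.constantCoeff_exp, map_one,
    mul_one, Polynomial.coe_C] at h

/-! ### The generating series of the labels. -/

namespace DHat

variable (lam : Module.Dual ℂ (grade 0))

theorem labelSeries_eq_egf : labelSeries lam = egf (-(extendByZero lam ∘ₗ zDLinear 0)) := by
  ext n
  rw [labelSeries, PowerSeries.coeff_mk, coeff_egf, LinearMap.neg_apply, LinearMap.comp_apply,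
    zDLinear_apply, extendByZero_of_mem lam (zD_mem_grade 0 _), label]

/-- Since eˣ shifts the argument and the labels carry a sign, the left side is the series of h ↦
λ(h(D) - h(D + 1)). This is ν without its term λ(C) h(0), whose series is the constant λ(C). -/
theorem exp_sub_one_mul_labelSeries : (PowerSeries.exp ℂ - 1) * labelSeries lam =
    egf (bracketFunctional lam) - PowerSeries.C (extendByZero lam central) := by
  rw [labelSeries_eq_egf, sub_mul, exp_mul_egf, one_mul]
  ext n
  simp only [map_sub, coeff_egf, LinearMap.comp_apply, LinearMap.neg_apply,
    AlgHom.toLinearMap_apply, bracketFunctional_apply]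
  have h : zD 0 (X ^ n - (X ^ n).comp (X + C 1)) =
      zDLinear 0 (X ^ n) - zDLinear 0 (aeval (X + C 1 : ℂ[X]) (X ^ n : ℂ[X])) := by
    rw [← map_sub, zDLinear_apply, aeval_def, algebraMap_eq]
    rfl
  rw [h, map_sub, PowerSeries.coeff_C]
  rcases n with _ | n
  · simp
  · simp only [Nat.add_eq_zero_iff, one_ne_zero, and_false, if_false, eval_pow, eval_X, ne_eq,
      not_false_eq_true, zero_pow, zero_mul]
    ring

end DHat

end

theorem theorem4p2 (lam : Module.Dual ℂ (DHat.grade 0)) :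
    HighestWeight.IsQuasifinite (HighestWeight.irreducibleGrade DHat.grade lam) ↔
      ∃ φ : PowerSeries ℂ, IsQuasipolynomial φ ∧ PowerSeries.constantCoeff φ = 0 ∧
        (DHat.labelSeries lam : LaurentSeries ℂ) =
          (φ : LaurentSeries ℂ) / ((PowerSeries.exp ℂ - 1 : PowerSeries ℂ) : LaurentSeries ℂ) := by
  have hne : ((PowerSeries.exp ℂ - 1 : PowerSeries ℂ) : LaurentSeries ℂ) ≠ 0 := by
    intro h
    rw [← PowerSeries.coe_zero, HahnSeries.ofPowerSeries_injective.eq_iff] at h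
    simpa [PowerSeries.coeff_exp, PowerSeries.coeff_one] using congrArg (PowerSeries.coeff 1) h
  -- Clearing the denominator leaves only one candidate for φ, so the theorem becomes a statement
  -- about the series of ν.
  have hφ : ∀ φ : PowerSeries ℂ, (DHat.labelSeries lam : LaurentSeries ℂ) =
      (φ : LaurentSeries ℂ) / ((PowerSeries.exp ℂ - 1 : PowerSeries ℂ) : LaurentSeries ℂ) ↔
      φ = egf (DHat.bracketFunctional lam) -
        PowerSeries.C (DHat.extendByZero lam DHat.central) := fun φ => by
    rw [eq_div_iff hne, ← PowerSeries.coe_mul, HahnSeries.ofPowerSeries_injective.eq_iff, mul_comm,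
      DHat.exp_sub_one_mul_labelSeries, eq_comm]
  rw [DHat.isQuasifinite_iff, ← isQuasipolynomial_egf_iff]
  constructor
  · intro h
    refine ⟨_, Submodule.sub_mem _ h (isQuasipolynomial_C _), ?_, (hφ _).mpr rfl⟩
    -- The condition φ(0) = 0 holds because φ is a multiple of eˣ - 1.
    rw [← DHat.exp_sub_one_mul_labelSeries, map_mul, map_sub, PowerSeries.constantCoeff_exp,
      map_one, sub_self, zero_mul]
  · rintro ⟨φ, hq, -, h⟩
    have := Submodule.add_mem _ hq (isQuasipolynomial_C (DHat.extendByZero lam DHat.central))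
    rwa [(hφ φ).mp h, sub_add_cancel] at this
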